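/- Let $L,\eta,\kappa,\beta,\tau>0$ and let $m,p,\delta\in W^{1,\infty}(0,L)$ (continuous representatives) be positive at every point of $[0,L]$. Let $$\mathcal H=H^1_0(0,L)\times L^2(0,L)\times L^2(0,L)\times L^2(0,L)$$ (real- or complex-valued functions) and let $\mathcal A$ be the operator in $\mathcal H$ given by $$\mathcal A(u,w,\theta,q)=\Big(w,\ \tfrac1m\big(p\,u_x+2\delta\,w_x-\eta\,\theta\big)_x,\ -\kappa\,q_x-\eta\,w_x,\ -\tfrac1\tau(\kappa\,\theta_x+\beta\,q)\Big)$$ on the domain $$D(\mathcal A)=\{(u,w,\theta,q)\in\mathcal H:\ w\in H^1_0(0,L),\ p\,u_x+2\delta\,w_x\in H^1(0,L),\ \theta\in H^1_0(0,L),\ q\in H^1(0,L)\}.$$ Thus $\frac{dU}{dt}=\mathcal A U$ with $U=(u,u_t,\theta,q)$ is the system $$m\,u_{tt}-(p\,u_x+2\delta\,u_{xt})_x+\eta\,\theta_x=0,\qquad \theta_t+\kappa\,q_x+\eta\,u_{xt}=0,\qquad \tau\,q_t+\beta\,q+\kappa\,\theta_x=0$$ with boundary conditions $u=\theta=0$ at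 $x=0$ and $x=L$. For $n\ge1$ put $$\mathcal E_n(t)=\frac12\Big[\int_0^L p\,|\partial_t^{n-1}u_x|^2\,dx+\int_0^L m\,|\partial_t^{n-1}u_t|^2\,dx+\int_0^L|\partial_t^{n-1}\theta|^2\,dx+\tau\int_0^L|\partial_t^{n-1}q|^2\,dx\Big].$$ Then there is a constant $C>0$, depending only on $L,m,p,\delta,\eta,\kappa,\beta,\tau$, such that for every integer $n\ge1$ and every $U_0\in D(\mathcal A^{n+1})$ the problem $\frac{dU}{dt}=\mathcal A U$, $U(0)=U_0$, has a unique strong solution $U\in C^1([0,\infty);\mathcal H)\cap C([0,\infty);D(\mathcal A))$, this solution belongs to $C^{n+1}([0,\infty);\mathcal H)$, and $$\mathcal E_n(t)\le\frac{C\,[\mathcal E_n(0)+\mathcal E_{n+1}(0)]}{t}\qquad\text{for all } t>0.$$ -/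

import Mathlib

noncomputable section

open MeasureTheory Set
open scoped ContDiff ENNReal

namespace Cattaneo

/-- `g` is the weak derivative of `f` on the interval `(0, L)`: integration by parts holds against
every test function in `C_c^∞(0, L)`. -/
def HasWeakDeriv {E : Type*} [NormedAddCommGroup E] [NormedSpace ℝ E]
    (L : ℝ) (f g : ℝ → E) : Prop :=
  ∀ φ : ℝ → ℝ, ContDiff ℝ ∞ φ → HasCompactSupport φ → tsupport φ ⊆ Ioo 0 L →
    ∫ x in Ioo 0 L, deriv φ x • f x = - ∫ x in Ioo 0 L, φ x • g x

/-- `f ∈ W^{1,∞}(0, L)`, given by its continuous representative on `[0, L]`. -/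
def IsW1Inf (L : ℝ) (f : ℝ → ℝ) : Prop :=
  ContinuousOn f (Icc 0 L) ∧
    ∃ g : ℝ → ℝ, MemLp g ∞ (volume.restrict (Ioo 0 L)) ∧ HasWeakDeriv L f g

/-- The Lebesgue space `L²(0, L)`. -/
abbrev L2 (𝕜 : Type*) [RCLike 𝕜] (L : ℝ) : Type _ :=
  Lp 𝕜 2 (volume.restrict (Ioo 0 L))

/-- `f` vanishes at both ends of `[0, L]`, in the sense that it has a representative that is
continuous on `[0, L]` and vanishes at `0` and at `L`. -/
def VanishesAtEnds {𝕜 : Type*} [RCLike 𝕜] {L : ℝ} (f : L2 𝕜 L) : Prop :=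
  ∃ r : ℝ → 𝕜, ContinuousOn r (Icc 0 L) ∧ r 0 = 0 ∧ r L = 0 ∧
    ∀ᵐ x ∂(volume.restrict (Ioo 0 L)), f x = r x

section
variable {𝕜 : Type*} [RCLike 𝕜] {L : ℝ}

theorem integrable_smul_test (f : L2 𝕜 L) {φ : ℝ → ℝ} (hφ : Continuous φ)
    (hc : HasCompactSupport φ) :
    Integrable (fun x => φ x • f x) (volume.restrict (Ioo 0 L)) := by
  have hf : Integrable f (volume.restrict (Ioo 0 L)) :=
    (Lp.memLp f).integrable (by norm_num)
  obtain ⟨K, hK⟩ := hc.exists_bound_of_continuous hφ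
  exact hf.bdd_smul K hφ.aestronglyMeasurable (Filter.Eventually.of_forall hK)

theorem HasWeakDeriv.add_L2 {f g f' g' : L2 𝕜 L} (h : HasWeakDeriv L f g)
    (h' : HasWeakDeriv L f' g') :
    HasWeakDeriv L (f + f' : L2 𝕜 L) (g + g' : L2 𝕜 L) := by
  intro φ hφ hc hs
  have hd : Continuous (deriv φ) := hφ.continuous_deriv (by simp)
  have e1 : ∫ x in Ioo 0 L, deriv φ x • (f + f' : L2 𝕜 L) x
      = ∫ x in Ioo 0 L, (deriv φ x • f x + deriv φ x • f' x) := by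
    refine integral_congr_ae ?_
    filter_upwards [Lp.coeFn_add f f'] with x hx
    rw [hx, Pi.add_apply, smul_add]
  have e2 : ∫ x in Ioo 0 L, φ x • (g + g' : L2 𝕜 L) x
      = ∫ x in Ioo 0 L, (φ x • g x + φ x • g' x) := by
    refine integral_congr_ae ?_
    filter_upwards [Lp.coeFn_add g g'] with x hx
    rw [hx, Pi.add_apply, smul_add]
  rw [e1, e2, integral_add (integrable_smul_test f hd hc.deriv)
    (integrable_smul_test f' hd hc.deriv),
    integral_add (integrable_smul_test g hφ.continuous hc)
    (integrable_smul_test g' hφ.continuous hc), h φ hφ hc hs, h' φ hφ hc hs, neg_add]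

theorem HasWeakDeriv.smul_L2 {f g : L2 𝕜 L} (c : 𝕜) (h : HasWeakDeriv L f g) :
    HasWeakDeriv L (c • f : L2 𝕜 L) (c • g : L2 𝕜 L) := by
  intro φ hφ hc hs
  have e1 : ∫ x in Ioo 0 L, deriv φ x • (c • f : L2 𝕜 L) x
      = ∫ x in Ioo 0 L, c • (deriv φ x • f x) := by
    refine integral_congr_ae ?_
    filter_upwards [Lp.coeFn_smul c f] with x hx
    rw [hx, Pi.smul_apply, smul_comm]
  have e2 : ∫ x in Ioo 0 L, φ x • (c • g : L2 𝕜 L) x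
      = ∫ x in Ioo 0 L, c • (φ x • g x) := by
    refine integral_congr_ae ?_
    filter_upwards [Lp.coeFn_smul c g] with x hx
    rw [hx, Pi.smul_apply, smul_comm]
  rw [e1, e2, integral_smul, integral_smul, h φ hφ hc hs, smul_neg]

theorem HasWeakDeriv.zero_L2 :
    HasWeakDeriv L (0 : L2 𝕜 L) (0 : L2 𝕜 L) := by
  intro φ hφ hc hs
  have e : ∀ ψ : ℝ → ℝ, ∫ x in Ioo 0 L, ψ x • (0 : L2 𝕜 L) x = 0 := by
    intro ψ
    refine integral_eq_zero_of_ae ?_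
    filter_upwards [Lp.coeFn_zero 𝕜 2 (volume.restrict (Ioo 0 L))] with x hx
    rw [hx]
    simp
  rw [e, e, neg_zero]

end

/-- The Sobolev space `H¹₀(0, L)`. An element is stored as the pair `(u, u_x)` of the function and
its weak derivative, both in `L²(0, L)`, so that the norm inherited from `L² × L²` is (equivalent
to) the `H¹` norm; the boundary condition is `u(0) = u(L) = 0`. -/
def H10 (𝕜 : Type*) [RCLike 𝕜] (L : ℝ) : Submodule 𝕜 (L2 𝕜 L × L2 𝕜 L) where
  carrier := {v | HasWeakDeriv L v.1 v.2 ∧ VanishesAtEnds v.1}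
  add_mem' := by
    rintro v v' ⟨h, r, hr, hr0, hrL, hvr⟩ ⟨h', r', hr', hr0', hrL', hvr'⟩
    refine ⟨h.add_L2 h', r + r', hr.add hr', by simp [hr0, hr0'], by simp [hrL, hrL'], ?_⟩
    filter_upwards [Lp.coeFn_add v.1 v'.1, hvr, hvr'] with x hx h1 h2
    rw [Prod.fst_add, hx, Pi.add_apply, Pi.add_apply, h1, h2]
  zero_mem' := by
    refine ⟨HasWeakDeriv.zero_L2, 0, continuousOn_const, rfl, rfl, ?_⟩
    exact Lp.coeFn_zero 𝕜 2 (volume.restrict (Ioo 0 L))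
  smul_mem' := by
    rintro c v ⟨h, r, hr, hr0, hrL, hvr⟩
    refine ⟨h.smul_L2 c, fun x => c • r x, hr.const_smul c, by simp [hr0], by simp [hrL], ?_⟩
    filter_upwards [Lp.coeFn_smul c v.1, hvr] with x hx h1
    rw [Prod.smul_fst, hx, Pi.smul_apply, h1]

/-- The function `u` underlying an element of `H¹₀(0, L)`. -/
def fn {𝕜 : Type*} [RCLike 𝕜] {L : ℝ} (u : H10 𝕜 L) : L2 𝕜 L := u.1.1

/-- The weak derivative `u_x` of an element of `H¹₀(0, L)`. -/
def dx {𝕜 : Type*} [RCLike 𝕜] {L : ℝ} (u : H10 𝕜 L) : L2 𝕜 L := u.1.2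

/-- The phase space `ℋ = H¹₀ × L² × L² × L²` of states `(u, w, θ, q)`, with the product topology
(which is that of the energy norm). -/
abbrev Phase (𝕜 : Type*) [RCLike 𝕜] (L : ℝ) : Type _ :=
  H10 𝕜 L × L2 𝕜 L × L2 𝕜 L × L2 𝕜 L

/-- The parameters of the system: length of the structure, coefficient functions and constants. -/
structure Params where
  L : ℝ
  m : ℝ → ℝ
  p : ℝ → ℝ
  δ : ℝ → ℝ
  η : ℝ
  κ : ℝ
  β : ℝ
  τ : ℝ

/-- The standing assumptions on the parameters. -/
structure Params.Admissible (P : Params) : Prop where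
  L_pos : 0 < P.L
  m_reg : IsW1Inf P.L P.m
  p_reg : IsW1Inf P.L P.p
  δ_reg : IsW1Inf P.L P.δ
  m_pos : ∀ x ∈ Icc 0 P.L, 0 < P.m x
  p_pos : ∀ x ∈ Icc 0 P.L, 0 < P.p x
  δ_pos : ∀ x ∈ Icc 0 P.L, 0 < P.δ x
  η_pos : 0 < P.η
  κ_pos : 0 < P.κ
  β_pos : 0 < P.β
  τ_pos : 0 < P.τ

/-- The graph of the operator `𝒜` with clamped ends and temperature zero at both ends:
`IsImage P U F` says that `U = (u, w, θ, q)` lies in `D(𝒜)`, that is `w, θ ∈ H¹₀`,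
`p u_x + 2 δ w_x ∈ H¹` and `q ∈ H¹`, and that `F = 𝒜 U`, where
`𝒜 U = (w, (p u_x + 2 δ w_x - η θ)_x / m, - κ q_x - η w_x, - (κ θ_x + β q) / τ)`. -/
def IsImage {𝕜 : Type*} [RCLike 𝕜] (P : Params) (U F : Phase 𝕜 P.L) : Prop :=
  match U, F with
  | (u, w, θ, q), (f₁, f₂, f₃, f₄) =>
    ∃ w' θ' : H10 𝕜 P.L, ∃ σx qx : L2 𝕜 P.L,
      fn w' = w ∧ fn θ' = θ ∧
      HasWeakDeriv P.L
        (fun x => (P.p x : 𝕜) * dx u x + 2 * (P.δ x : 𝕜) * dx w' x) σx ∧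
      HasWeakDeriv P.L q qx ∧
      f₁ = w' ∧
      (∀ᵐ x ∂(volume.restrict (Ioo 0 P.L)),
        f₂ x = (P.m x : 𝕜)⁻¹ * (σx x - (P.η : 𝕜) * dx θ' x)) ∧
      f₃ = - (P.κ : 𝕜) • qx - (P.η : 𝕜) • dx w' ∧
      f₄ = - (P.τ : 𝕜)⁻¹ • ((P.κ : 𝕜) • dx θ' + (P.β : 𝕜) • q)

/-- `MemDomPow P k U` says that `U ∈ D(𝒜ᵏ)`. -/
def MemDomPow {𝕜 : Type*} [RCLike 𝕜] (P : Params) : ℕ → Phase 𝕜 P.L → Prop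
  | 0, _ => True
  | k + 1, U => ∃ F : Phase 𝕜 P.L, IsImage P U F ∧ MemDomPow P k F

/-- `U` (restricted to `[0, ∞)`) is a strong solution of `dU/dt = 𝒜 U`, `U(0) = U₀`: it belongs to
`C¹([0, ∞); ℋ)`, takes values in `D(𝒜)` and satisfies the equation. Since `𝒜 U = dU/dt` is
continuous in `ℋ`, it also belongs to `C([0, ∞); D(𝒜))`. -/
structure IsStrongSolution {𝕜 : Type*} [RCLike 𝕜] (P : Params) (U₀ : Phase 𝕜 P.L)
    (U : ℝ → Phase 𝕜 P.L) : Prop where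
  init : U 0 = U₀
  contDiffOn : ContDiffOn ℝ 1 U (Ici 0)
  eqn : ∀ t, 0 ≤ t → IsImage P (U t) (derivWithin U (Ici 0) t)

/-- The quadratic energy of a state
`½ (∫ p |u_x|² + ∫ m |w|² + ∫ |θ|² + τ ∫ |q|²)`. -/
def stateEnergy {𝕜 : Type*} [RCLike 𝕜] (P : Params) (V : Phase 𝕜 P.L) : ℝ :=
  match V with
  | (u, w, θ, q) =>
    (1 / 2) * ((∫ x in Ioo 0 P.L, P.p x * ‖dx u x‖ ^ 2)
      + (∫ x in Ioo 0 P.L, P.m x * ‖w x‖ ^ 2)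
      + (∫ x in Ioo 0 P.L, ‖θ x‖ ^ 2)
      + P.τ * ∫ x in Ioo 0 P.L, ‖q x‖ ^ 2)

/-- The energy of order `n ≥ 1` of `U = (u, u_t, θ, q)` at time `t`: the quadratic energy of the
time derivative of order `n - 1` (one-sided at `t = 0`), so that the energy of order one contains
no additional time derivative and the energy of order two contains one. -/
def energy {𝕜 : Type*} [RCLike 𝕜] (P : Params) (n : ℕ) (U : ℝ → Phase 𝕜 P.L) (t : ℝ) : ℝ :=
  stateEnergy P (iteratedDerivWithin (n - 1) U (Ici 0) t)

end Cattaneo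

end

/-!
Measure the state `(u, w, θ, q)` by the vector `(√p u_x, √m w, θ, √τ q)`. In this norm the operator
satisfies `Re ⟨𝒜 U, U⟩ = -(2 ∫ δ |w_x|² + β ∫ |q|²)`: the cross terms cancel after integrating by
parts. It is therefore dissipative, and `λ - 𝒜` is onto for every `λ > 0` because the resolvent
equation reduces to a coercive variational problem, so Hille and Yosida's approximation yields the
solutions and their regularity.

The dissipation of `U` alone sees neither `u` nor `θ`, but that of `U` and `U_t` together
controls the whole energy: the heat flux equation gives `θ_x` in terms of `q` and `q_t`, and testing
the equation of motion with `u` gives `u_x`. Hence, for a suitable `C`, the function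
`t E_n + C (E_n + E_{n+1})` is nonincreasing, and its value at `0` bounds `t E_n(t)`.
-/

noncomputable section

open MeasureTheory Set
open scoped ContDiff ENNReal

namespace Cattaneo

open Filter Topology

section HilleYosida

variable {X : Type*} [NormedAddCommGroup X] [NormedSpace ℝ X]

/-- `A ⊆ X × X` is the graph of a densely defined m-dissipative operator, the hypothesis of the
Hille–Yosida theorem. Working with graphs avoids a separate notion of unbounded operator;
single-valuedness follows from the three conditions. -/
structure IsMDissipative (A : Submodule ℝ (X × X)) : Prop where
  dense_domain : Dense {x : X | ∃ y, (x, y) ∈ A}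
  mul_norm_le : ∀ {x y : X}, (x, y) ∈ A → ∀ l : ℝ, 0 < l → l * ‖x‖ ≤ ‖l • x - y‖
  exists_smul_sub_eq : ∀ l : ℝ, 0 < l → ∀ f : X, ∃ x y, (x, y) ∈ A ∧ l • x - y = f

/-- `R` is the contractive resolvent `(l - A)⁻¹` of the operator with graph `A`. -/
structure IsResolvent (A : Submodule ℝ (X × X)) (l : ℝ) (R : X →L[ℝ] X) : Prop where
  mem : ∀ f, (R f, l • R f - f) ∈ A
  apply_smul_sub : ∀ {x y}, (x, y) ∈ A → R (l • x - y) = x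
  mul_norm_le : ∀ f, l * ‖R f‖ ≤ ‖f‖

/-- `S` solves the abstract Cauchy problem of the operator with graph `A`: its orbits are
continuous, and those that start in the domain are classical solutions on `[0, ∞)` whose
derivatives are again orbits. -/
structure IsSolutionFamily (A : Submodule ℝ (X × X)) (S : ℝ → X → X) : Prop where
  zero_apply : ∀ x, S 0 x = x
  continuous_orbit : ∀ x, Continuous fun t => S t x
  mem : ∀ {x y : X}, (x, y) ∈ A → ∀ {t : ℝ}, 0 ≤ t → (S t x, S t y) ∈ A
  hasDerivWithinAt : ∀ {x y : X}, (x, y) ∈ A → ∀ {t : ℝ}, 0 ≤ t →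
    HasDerivWithinAt (fun s => S s x) (S t y) (Ici 0) t

variable {A : Submodule ℝ (X × X)} {l k : ℝ} {R Q B C : X →L[ℝ] X}

theorem IsMDissipative.eq_of_smul_sub_eq (hA : IsMDissipative A) (hl : 0 < l) {x y x' y' : X}
    (h : (x, y) ∈ A) (h' : (x', y') ∈ A) (heq : l • x - y = l • x' - y') : x = x' := by
  have hle := hA.mul_norm_le (A.sub_mem h h') l hl
  rw [smul_sub, sub_sub_sub_comm, heq, sub_self, norm_zero] at hle
  exact sub_eq_zero.mp (norm_le_zero_iff.mp (nonpos_of_mul_nonpos_right hle hl))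

theorem IsMDissipative.exists_isResolvent (hA : IsMDissipative A) (hl : 0 < l) :
    ∃ R, IsResolvent A l R := by
  choose x y hmem heq using hA.exists_smul_sub_eq l hl
  have x_eq {f x' y' : X} (h : (x', y') ∈ A) (h' : l • x' - y' = f) : x f = x' :=
    hA.eq_of_smul_sub_eq hl (hmem f) h (by rw [heq, h'])
  let R : X →ₗ[ℝ] X :=
    { toFun := x
      map_add' := fun f g => x_eq (A.add_mem (hmem f) (hmem g)) (by
        rw [smul_add, add_sub_add_comm, heq, heq])
      map_smul' := fun c f => x_eq (A.smul_mem c (hmem f)) (by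
        rw [RingHom.id_apply, smul_comm, ← smul_sub, heq]) }
  have hbound (f : X) : l * ‖x f‖ ≤ ‖f‖ := by
    simpa only [heq] using hA.mul_norm_le (hmem f) l hl
  refine ⟨R.mkContinuous l⁻¹ fun f => ?_, fun f => ?_, fun h => x_eq h rfl, hbound⟩
  · rw [inv_mul_eq_div, le_div_iff₀' hl]
    exact hbound f
  · change (x f, l • x f - f) ∈ A
    rw [sub_eq_of_eq_add' (sub_eq_iff_eq_add.mp (heq f))]
    exact hmem f

namespace IsResolvent

theorem smul_apply_sub (hR : IsResolvent A l R) {x y : X} (h : (x, y) ∈ A) :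
    l • R x - x = R y := by
  rw [sub_eq_iff_eq_add, ← sub_eq_iff_eq_add', ← map_smul, ← map_sub, hR.apply_smul_sub h]

theorem map_mem (hR : IsResolvent A l R) {x y : X} (h : (x, y) ∈ A) : (R x, R y) ∈ A :=
  hR.smul_apply_sub h ▸ hR.mem x

theorem commute (hR : IsResolvent A l R) (hQ : IsResolvent A k Q) : Commute R Q := by
  ext f
  have h := hQ.apply_smul_sub (hR.map_mem (hQ.mem f))
  rw [← map_smul, ← map_sub, sub_sub_cancel] at h
  exact h.symm

theorem norm_smul_apply_le (hR : IsResolvent A l R) (hl : 0 < l) (f : X) : ‖l • R f‖ ≤ ‖f‖ := by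
  rw [norm_smul, Real.norm_of_nonneg hl.le]
  exact hR.mul_norm_le f

theorem norm_smul_le (hR : IsResolvent A l R) (hl : 0 < l) : ‖l • R‖ ≤ 1 :=
  ContinuousLinearMap.opNorm_le_bound _ zero_le_one fun f =>
    (hR.norm_smul_apply_le hl f).trans_eq (one_mul _).symm

end IsResolvent

/-- The Yosida approximation `l (l R - 1)` of an operator with resolvent `R` at `l`. -/
def yosida (l : ℝ) (R : X →L[ℝ] X) : X →L[ℝ] X := l • (l • R - 1)

theorem yosida_apply_of_mem (hR : IsResolvent A l R) {x y : X} (h : (x, y) ∈ A) :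
    yosida l R x = l • R y := by
  rw [← hR.smul_apply_sub h]
  rfl

theorem commute_yosida_right (h : Commute R Q) : Commute R (yosida k Q) :=
  ((h.smul_right k).sub_right (Commute.one_right R)).smul_right k

theorem commute_yosida (h : Commute R Q) : Commute (yosida l R) (yosida k Q) :=
  (commute_yosida_right (commute_yosida_right h).symm).symm

theorem exp_smul_comp_apply (h : Commute B C) (t : ℝ) (x : X) :
    NormedSpace.exp (t • B) (C x) = C (NormedSpace.exp (t • B) x) :=
  congrArg (fun T : X →L[ℝ] X => T x) (h.symm.smul_right t).exp_right.eq.symm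

theorem norm_exp_le_exp_norm (B : X →L[ℝ] X) : ‖NormedSpace.exp B‖ ≤ Real.exp ‖B‖ := by
  rcases subsingleton_or_nontrivial X with _ | _
  · rw [Subsingleton.elim (NormedSpace.exp B) 0, norm_zero]
    positivity
  · rw [NormedSpace.exp_eq_tsum ℝ, Real.exp_eq_exp_ℝ, NormedSpace.exp_eq_tsum ℝ]
    refine tsum_of_norm_bounded (NormedSpace.expSeries_summable' ‖B‖).hasSum fun n => ?_
    rw [norm_smul, Real.norm_of_nonneg (by positivity)]
    exact mul_le_mul_of_nonneg_left (norm_pow_le B n) (by positivity)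

/-- The contraction semigroup generated by the Yosida approximation, extended by the identity to
negative times so that its orbits are continuous on the whole line. -/
def yosidaFlow (l : ℝ) (R : X →L[ℝ] X) (t : ℝ) : X →L[ℝ] X :=
  NormedSpace.exp (max t 0 • yosida l R)

theorem yosidaFlow_zero : yosidaFlow l R 0 = 1 := by
  rw [yosidaFlow, max_self, zero_smul, NormedSpace.exp_zero]

theorem yosidaFlow_comp_apply (h : Commute Q R) (t : ℝ) (x : X) :
    yosidaFlow l R t (Q x) = Q (yosidaFlow l R t x) :=
  exp_smul_comp_apply (commute_yosida_right h).symm _ x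

-- The limit commutes with the resolvent, whose range is the domain.
theorem mem_of_tendsto_yosidaFlow {R : ℕ → X →L[ℝ] X} {S : ℝ → X → X} {x y : X}
    (hR : ∀ n : ℕ, IsResolvent A (n + 1) (R n))
    (hS : ∀ t x, Tendsto (fun n : ℕ => yosidaFlow (n + 1) (R n) t x) atTop (𝓝 (S t x)))
    (h : (x, y) ∈ A) (t : ℝ) : (S t x, S t y) ∈ A := by
  have hcomm (z : X) : S t (R 0 z) = R 0 (S t z) := by
    refine tendsto_nhds_unique (hS t (R 0 z)) ?_
    exact (((R 0).continuous.tendsto _).comp (hS t z)).congr fun n =>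
      (yosidaFlow_comp_apply ((hR 0).commute (hR n)) t z).symm
  have hsub : S t (x - y) = S t x - S t y :=
    tendsto_nhds_unique (hS t (x - y)) (by simpa only [map_sub] using (hS t x).sub (hS t y))
  have hx := (hR 0).apply_smul_sub h
  have hmem := (hR 0).mem (S t (x - y))
  simp only [Nat.cast_zero, zero_add, one_smul] at hx hmem
  rwa [← hcomm, hx, hsub, sub_sub_cancel] at hmem

theorem tendsto_smul_resolvent {R : ℕ → X →L[ℝ] X} (hA : IsMDissipative A)
    (hR : ∀ n : ℕ, IsResolvent A (n + 1) (R n)) (y : X) :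
    Tendsto (fun n : ℕ => ((n : ℝ) + 1) • R n y) atTop (𝓝 y) := by
  have hpos (n : ℕ) : (0 : ℝ) < n + 1 := by positivity
  have tendsto_of_mem {x x' : X} (hx : (x, x') ∈ A) :
      Tendsto (fun n : ℕ => ((n : ℝ) + 1) • R n x) atTop (𝓝 x) := by
    rw [tendsto_iff_norm_sub_tendsto_zero]
    refine squeeze_zero (fun _ => norm_nonneg _) (fun n => ?_)
      (by simpa using tendsto_one_div_add_atTop_nhds_zero_nat.mul_const ‖x'‖)
    rw [(hR n).smul_apply_sub hx, inv_mul_eq_div, le_div_iff₀' (hpos n)]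
    exact (hR n).mul_norm_le x'
  rw [Metric.tendsto_atTop]
  intro ε hε
  obtain ⟨x, hyx, x', hx⟩ := Metric.dense_iff.mp hA.dense_domain y (ε / 3) (by positivity)
  obtain ⟨N, hN⟩ := Metric.tendsto_atTop.mp (tendsto_of_mem hx) (ε / 3) (by positivity)
  refine ⟨N, fun n hn => ?_⟩
  have hnear : dist (((n : ℝ) + 1) • R n y) (((n : ℝ) + 1) • R n x) ≤ dist x y := by
    rw [dist_eq_norm, dist_eq_norm', ← smul_sub, ← map_sub]
    exact (hR n).norm_smul_apply_le (hpos n) _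
  have hxy : dist x y < ε / 3 := hyx
  linarith [hN n hn, dist_triangle4 (((n : ℝ) + 1) • R n y) (((n : ℝ) + 1) • R n x) x y]

variable [CompleteSpace X]

theorem norm_exp_smul_yosida_le (hR : IsResolvent A l R) (hl : 0 < l) {t : ℝ} (ht : 0 ≤ t) :
    ‖NormedSpace.exp (t • yosida l R)‖ ≤ 1 := by
  let _ : NormedAlgebra ℚ (X →L[ℝ] X) := .restrictScalars ℚ ℝ _
  have hsplit : t • yosida l R = (t * l) • (l • R) + algebraMap ℝ (X →L[ℝ] X) (-(t * l)) := by
    rw [yosida, Algebra.algebraMap_eq_smul_one, smul_smul, smul_sub, neg_smul, sub_eq_add_neg]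
  have hnorm : ‖(t * l) • (l • R)‖ ≤ t * l := by
    rw [norm_smul, Real.norm_of_nonneg (by positivity)]
    exact mul_le_of_le_one_right (by positivity) (hR.norm_smul_le hl)
  rw [hsplit, NormedSpace.exp_add_of_commute (Algebra.commutes _ _).symm,
    ← NormedSpace.algebraMap_exp_comm, ← Real.exp_eq_exp_ℝ, Algebra.algebraMap_eq_smul_one,
    mul_smul_one, norm_smul, Real.norm_of_nonneg (Real.exp_nonneg _)]
  calc Real.exp (-(t * l)) * ‖NormedSpace.exp ((t * l) • (l • R))‖
      ≤ Real.exp (-(t * l)) * Real.exp (t * l) := by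
        gcongr
        exact (norm_exp_le_exp_norm _).trans (Real.exp_le_exp.mpr hnorm)
    _ = 1 := by rw [← Real.exp_add, neg_add_cancel, Real.exp_zero]

theorem hasDerivAt_exp_smul_apply (B : X →L[ℝ] X) (x : X) (t : ℝ) :
    HasDerivAt (fun s : ℝ => NormedSpace.exp (s • B) x) (NormedSpace.exp (t • B) (B x)) t := by
  simpa using (hasDerivAt_exp_smul_const B t).clm_apply (hasDerivAt_const t x)

theorem continuous_exp_smul_apply (B : X →L[ℝ] X) (x : X) :
    Continuous fun t : ℝ => NormedSpace.exp (t • B) x :=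
  continuous_iff_continuousAt.mpr fun t => (hasDerivAt_exp_smul_apply B x t).continuousAt

-- The difference is the integral of the derivative of `s ↦ exp ((t - s) C) exp (s B) x`.
theorem norm_exp_smul_sub_exp_smul_le (hB : ∀ t : ℝ, 0 ≤ t → ‖NormedSpace.exp (t • B)‖ ≤ 1)
    (hC : ∀ t : ℝ, 0 ≤ t → ‖NormedSpace.exp (t • C)‖ ≤ 1) (hBC : Commute B C) (x : X)
    {t : ℝ} (ht : 0 ≤ t) :
    ‖NormedSpace.exp (t • B) x - NormedSpace.exp (t • C) x‖ ≤ t * ‖B x - C x‖ := by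
  let g : ℝ → X := fun s => NormedSpace.exp ((t - s) • C) (NormedSpace.exp (s • B) x)
  have hg (s : ℝ) : HasDerivAt g
      (NormedSpace.exp ((t - s) • C) (NormedSpace.exp (s • B) (B x - C x))) s := by
    have houter : HasDerivAt (fun s : ℝ => NormedSpace.exp ((t - s) • C))
        (-(NormedSpace.exp ((t - s) • C) * C)) s := by
      simpa [Function.comp_def] using
        (hasDerivAt_exp_smul_const C (t - s)).scomp s ((hasDerivAt_id s).const_sub t)
    convert houter.clm_apply (hasDerivAt_exp_smul_apply B x s) using 1
    simp [exp_smul_comp_apply hBC, sub_eq_add_neg, add_comm]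
  have hg_le (s : ℝ) (hs : s ∈ Ico 0 t) :
      ‖NormedSpace.exp ((t - s) • C) (NormedSpace.exp (s • B) (B x - C x))‖ ≤ ‖B x - C x‖ :=
    calc _ ≤ ‖NormedSpace.exp (s • B) (B x - C x)‖ := by
          simpa only [one_mul] using
            ContinuousLinearMap.le_of_opNorm_le _ (hC _ (sub_nonneg.mpr hs.2.le)) _
      _ ≤ ‖B x - C x‖ := by
          simpa only [one_mul] using ContinuousLinearMap.le_of_opNorm_le _ (hB s hs.1) _
  simpa [g, NormedSpace.exp_zero, mul_comm] using
    norm_image_sub_le_of_norm_deriv_le_segment' (fun s _ => (hg s).hasDerivWithinAt) hg_le t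
      (right_mem_Icc.mpr ht)

theorem continuous_yosidaFlow_apply (x : X) : Continuous fun t => yosidaFlow l R t x :=
  (continuous_exp_smul_apply _ x).comp (continuous_id.max continuous_const)

theorem norm_yosidaFlow_apply_le (hR : IsResolvent A l R) (hl : 0 < l) (t : ℝ) (x : X) :
    ‖yosidaFlow l R t x‖ ≤ ‖x‖ :=
  (ContinuousLinearMap.le_of_opNorm_le _ (norm_exp_smul_yosida_le hR hl (le_max_right t 0))
    x).trans_eq (one_mul _)

theorem norm_yosidaFlow_sub_le (hR : IsResolvent A l R) (hl : 0 < l) (hQ : IsResolvent A k Q)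
    (hk : 0 < k) (t : ℝ) (x : X) :
    ‖yosidaFlow l R t x - yosidaFlow k Q t x‖ ≤ max t 0 * ‖yosida l R x - yosida k Q x‖ :=
  norm_exp_smul_sub_exp_smul_le (fun _ => norm_exp_smul_yosida_le hR hl)
    (fun _ => norm_exp_smul_yosida_le hQ hk) (commute_yosida (hR.commute hQ)) x (le_max_right t 0)

theorem yosidaFlow_apply_eq_add_integral (x : X) {t : ℝ} (ht : 0 ≤ t) :
    yosidaFlow l R t x = x + ∫ s in (0 : ℝ)..t, yosidaFlow l R s (yosida l R x) := by
  have hintegrand : ∫ s in (0 : ℝ)..t, yosidaFlow l R s (yosida l R x)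
      = ∫ s in (0 : ℝ)..t, NormedSpace.exp (s • yosida l R) (yosida l R x) := by
    refine intervalIntegral.integral_congr fun s hs => ?_
    rw [uIcc_of_le ht] at hs
    simp only [yosidaFlow, max_eq_left hs.1]
  rw [hintegrand, intervalIntegral.integral_eq_sub_of_hasDerivAt
    (fun s _ => hasDerivAt_exp_smul_apply _ x s)
    ((continuous_exp_smul_apply _ _).intervalIntegrable _ _), yosidaFlow, max_eq_left ht]
  simp [NormedSpace.exp_zero]

section Limit

variable {R : ℕ → X →L[ℝ] X} {S : ℝ → X → X} {x y : X}

theorem uniformCauchySeqOn_yosidaFlow (hA : IsMDissipative A)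
    (hR : ∀ n : ℕ, IsResolvent A (n + 1) (R n)) (x : X) (T : ℝ) :
    UniformCauchySeqOn (fun (n : ℕ) t => yosidaFlow (n + 1) (R n) t x) atTop (Iic T) := by
  have hpos (n : ℕ) : (0 : ℝ) < n + 1 := by positivity
  rw [Metric.uniformCauchySeqOn_iff]
  intro ε hε
  obtain ⟨z, hzx, z', hz⟩ := Metric.dense_iff.mp hA.dense_domain x (ε / 3) (by positivity)
  have hzx : dist z x < ε / 3 := hzx
  have hcauchy : CauchySeq fun n : ℕ => yosida (n + 1) (R n) z := by
    simp only [fun n => yosida_apply_of_mem (hR n) hz]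
    exact (tendsto_smul_resolvent hA hR z').cauchySeq
  obtain ⟨N, hN⟩ := Metric.cauchySeq_iff.mp hcauchy (ε / (3 * (max T 0 + 1))) (by positivity)
  refine ⟨N, fun m hm n hn t ht => ?_⟩
  have hz_close : dist (yosidaFlow (m + 1) (R m) t z) (yosidaFlow (n + 1) (R n) t z) ≤ ε / 3 := by
    rw [dist_eq_norm]
    refine (norm_yosidaFlow_sub_le (hR m) (hpos m) (hR n) (hpos n) t z).trans ?_
    have hlt := hN m hm n hn
    rw [dist_eq_norm, lt_div_iff₀ (by positivity)] at hlt
    have htT : max t 0 ≤ max T 0 := max_le_max_right 0 ht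
    nlinarith [norm_nonneg (yosida (m + 1) (R m) z - yosida (n + 1) (R n) z)]
  have hx_close (n : ℕ) :
      dist (yosidaFlow (n + 1) (R n) t x) (yosidaFlow (n + 1) (R n) t z) < ε / 3 := by
    rw [dist_eq_norm, ← map_sub]
    exact (norm_yosidaFlow_apply_le (hR n) (hpos n) t _).trans_lt (by rwa [← dist_eq_norm'])
  have hn_close := hx_close n
  rw [dist_comm] at hn_close
  linarith [hx_close m, dist_triangle4 (yosidaFlow (m + 1) (R m) t x)
    (yosidaFlow (m + 1) (R m) t z) (yosidaFlow (n + 1) (R n) t z) (yosidaFlow (n + 1) (R n) t x)]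

theorem exists_tendsto_yosidaFlow (hA : IsMDissipative A)
    (hR : ∀ n : ℕ, IsResolvent A (n + 1) (R n)) : ∃ S : ℝ → X → X, ∀ t x,
      Tendsto (fun n : ℕ => yosidaFlow (n + 1) (R n) t x) atTop (𝓝 (S t x)) := by
  choose S hS using fun t x => cauchySeq_tendsto_of_complete
    ((uniformCauchySeqOn_yosidaFlow hA hR x t).cauchySeq self_mem_Iic)
  exact ⟨S, hS⟩

theorem continuous_limit_yosidaFlow (hA : IsMDissipative A)
    (hR : ∀ n : ℕ, IsResolvent A (n + 1) (R n))
    (hS : ∀ t x, Tendsto (fun n : ℕ => yosidaFlow (n + 1) (R n) t x) atTop (𝓝 (S t x))) (x : X) :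
    Continuous fun t => S t x :=
  continuous_iff_continuousAt.mpr fun t =>
    ((uniformCauchySeqOn_yosidaFlow hA hR x (t + 1)).tendstoUniformlyOn_of_tendsto
      fun s _ => hS s x).continuousOn
        (Frequently.of_forall fun _ => (continuous_yosidaFlow_apply x).continuousOn)
      |>.continuousAt (Iic_mem_nhds (lt_add_one t))

theorem tendsto_yosidaFlow_yosida (hA : IsMDissipative A)
    (hR : ∀ n : ℕ, IsResolvent A (n + 1) (R n))
    (hS : ∀ t x, Tendsto (fun n : ℕ => yosidaFlow (n + 1) (R n) t x) atTop (𝓝 (S t x)))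
    (h : (x, y) ∈ A) (t : ℝ) :
    Tendsto (fun n : ℕ => yosidaFlow (n + 1) (R n) t (yosida (n + 1) (R n) x)) atTop
      (𝓝 (S t y)) := by
  refine tendsto_of_tendsto_of_dist (hS t y) (squeeze_zero (fun _ => dist_nonneg) (fun n => ?_)
    (tendsto_iff_dist_tendsto_zero.mp (tendsto_smul_resolvent hA hR y)))
  rw [dist_eq_norm', dist_eq_norm, ← map_sub, yosida_apply_of_mem (hR n) h]
  exact norm_yosidaFlow_apply_le (hR n) (by positivity) t _

theorem limit_yosidaFlow_eq_add_integral (hA : IsMDissipative A)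
    (hR : ∀ n : ℕ, IsResolvent A (n + 1) (R n))
    (hS : ∀ t x, Tendsto (fun n : ℕ => yosidaFlow (n + 1) (R n) t x) atTop (𝓝 (S t x)))
    (h : (x, y) ∈ A) {t : ℝ} (ht : 0 ≤ t) : S t x = x + ∫ s in (0 : ℝ)..t, S s y := by
  have hbound (n : ℕ) (s : ℝ) :
      ‖yosidaFlow (n + 1) (R n) s (yosida (n + 1) (R n) x)‖ ≤ ‖y‖ := by
    refine (norm_yosidaFlow_apply_le (hR n) (by positivity) s _).trans ?_
    rw [yosida_apply_of_mem (hR n) h]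
    exact (hR n).norm_smul_apply_le (by positivity) y
  have hlim : Tendsto (fun n : ℕ => ∫ s in (0 : ℝ)..t,
      yosidaFlow (n + 1) (R n) s (yosida (n + 1) (R n) x)) atTop (𝓝 (∫ s in (0 : ℝ)..t, S s y)) :=
    intervalIntegral.tendsto_integral_filter_of_dominated_convergence (fun _ => ‖y‖)
      (.of_forall fun _ => (continuous_yosidaFlow_apply _).aestronglyMeasurable)
      (.of_forall fun n => .of_forall fun s _ => hbound n s) intervalIntegrable_const
      (.of_forall fun s _ => tendsto_yosidaFlow_yosida hA hR hS h s)
  exact tendsto_nhds_unique (hS t x)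
    ((hlim.const_add x).congr fun _ => (yosidaFlow_apply_eq_add_integral x ht).symm)

end Limit

/-- The **Hille–Yosida theorem** for contraction semigroups. -/
theorem IsMDissipative.exists_isSolutionFamily (hA : IsMDissipative A) :
    ∃ S, IsSolutionFamily A S := by
  choose R hR using fun n : ℕ => hA.exists_isResolvent (l := (n : ℝ) + 1) (by positivity)
  obtain ⟨S, hS⟩ := exists_tendsto_yosidaFlow hA hR
  have hcont := continuous_limit_yosidaFlow hA hR hS
  refine ⟨S, fun x => tendsto_nhds_unique (hS 0 x) (by simp [yosidaFlow_zero]), hcont,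
    fun h t _ => mem_of_tendsto_yosidaFlow hR hS h t, fun {x y} h t ht => ?_⟩
  have hderiv := ((hcont y).integral_hasStrictDerivAt 0 t).hasDerivAt.const_add x
  exact hderiv.hasDerivWithinAt.congr (fun s hs => limit_yosidaFlow_eq_add_integral hA hR hS h hs)
    (limit_yosidaFlow_eq_add_integral hA hR hS h ht)

end HilleYosida

section Dissipative

variable {H : Type*} [NormedAddCommGroup H] [InnerProductSpace ℝ H]

theorem dense_domain_of_inner_nonpos [CompleteSpace H] {A : Submodule ℝ (H × H)}
    (dissip : ∀ {x y}, (x, y) ∈ A → inner ℝ x y ≤ 0) (single : ∀ {y}, (0, y) ∈ A → y = 0)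
    (surj : ∀ f, ∃ x y, (x, y) ∈ A ∧ x - y = f) : Dense {x | ∃ y, (x, y) ∈ A} := by
  have hdomain : {x | ∃ y, (x, y) ∈ A} = (A.map (LinearMap.fst ℝ H H) : Set H) := by
    ext x
    simp
  rw [hdomain, Submodule.dense_iff_topologicalClosure_eq_top,
    Submodule.topologicalClosure_eq_top_iff, Submodule.eq_bot_iff]
  intro f hf
  obtain ⟨x, y, hxy, rfl⟩ := surj f
  have horth : inner ℝ x (x - y) = 0 :=
    (Submodule.mem_orthogonal _ _).mp hf x ⟨(x, y), hxy, rfl⟩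
  rw [inner_sub_right, real_inner_self_eq_norm_sq] at horth
  obtain rfl : x = 0 :=
    norm_eq_zero.mp (sq_nonpos_iff _ |>.mp ((sub_eq_zero.mp horth).trans_le (dissip hxy)))
  rw [single hxy, sub_zero]

/-- The **Lumer–Phillips criterion** in a Hilbert space, where density of the domain is
automatic. -/
theorem IsMDissipative.of_inner_nonpos [CompleteSpace H] {A : Submodule ℝ (H × H)}
    (dissip : ∀ {x y}, (x, y) ∈ A → inner ℝ x y ≤ 0) (single : ∀ {y}, (0, y) ∈ A → y = 0)
    (surj : ∀ l : ℝ, 0 < l → ∀ f, ∃ x y, (x, y) ∈ A ∧ l • x - y = f) : IsMDissipative A where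
  dense_domain := dense_domain_of_inner_nonpos dissip single
    (by simpa only [one_smul] using surj 1 one_pos)
  mul_norm_le {x y} h l _ := by
    rcases eq_or_ne x 0 with rfl | hx
    · simp
    · refine le_of_mul_le_mul_left ?_ (norm_pos_iff.mpr hx)
      calc ‖x‖ * (l * ‖x‖) = inner ℝ x (l • x) := by
            rw [inner_smul_right, real_inner_self_eq_norm_mul_norm, mul_left_comm]
        _ ≤ inner ℝ x (l • x - y) := by
            rw [inner_sub_right]
            linarith [dissip h]
        _ ≤ ‖x‖ * ‖l • x - y‖ := real_inner_le_norm _ _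
  exists_smul_sub_eq := surj

theorem norm_sq_antitoneOn {f f' : ℝ → H}
    (hf : ∀ t, 0 ≤ t → HasDerivWithinAt f (f' t) (Ici 0) t)
    (hd : ∀ t, 0 ≤ t → inner ℝ (f t) (f' t) ≤ 0) : AntitoneOn (fun t => ‖f t‖ ^ 2) (Ici 0) := by
  have hderiv (t : ℝ) (ht : t ∈ Ici (0 : ℝ)) := (hf t ht).norm_sq
  refine antitoneOn_of_hasDerivWithinAt_nonpos (convex_Ici 0)
    (fun t ht => (hderiv t ht).continuousWithinAt)
    (fun t ht => (hderiv t (interior_subset ht)).mono interior_subset) fun t ht => ?_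
  exact mul_nonpos_of_nonneg_of_nonpos zero_le_two (hd t (interior_subset ht))

/-- If the dissipation of a curve and of its time derivative together control its energy, then
the energy is `O(1/t)`, because `t ‖x‖² + C (‖x‖² + ‖x'‖²)` is nonincreasing. -/
theorem mul_norm_sq_le_of_norm_sq_le_dissipation {C : ℝ} (hC : 0 ≤ C) {x y z : ℝ → H}
    (hx : ∀ t, 0 ≤ t → HasDerivWithinAt x (y t) (Ici 0) t)
    (hy : ∀ t, 0 ≤ t → HasDerivWithinAt y (z t) (Ici 0) t)
    (hxy : ∀ t, 0 ≤ t → inner ℝ (x t) (y t) ≤ 0)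
    (hxyz : ∀ t, 0 ≤ t → ‖x t‖ ^ 2 ≤ C * (-inner ℝ (x t) (y t) - inner ℝ (y t) (z t)))
    {t : ℝ} (ht : 0 ≤ t) : t * ‖x t‖ ^ 2 ≤ C * (‖x 0‖ ^ 2 + ‖y 0‖ ^ 2) := by
  have hderiv (s : ℝ) (hs : s ∈ Ici (0 : ℝ)) :=
    ((hasDerivWithinAt_id s _).mul (hx s hs).norm_sq).add
      (((hx s hs).norm_sq.add (hy s hs).norm_sq).const_mul C)
  have hanti : AntitoneOn (fun s => s * ‖x s‖ ^ 2 + C * (‖x s‖ ^ 2 + ‖y s‖ ^ 2)) (Ici 0) := by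
    refine antitoneOn_of_hasDerivWithinAt_nonpos (convex_Ici 0)
      (fun s hs => (hderiv s hs).continuousWithinAt)
      (fun s hs => (hderiv s (interior_subset hs)).mono interior_subset) fun s hs => ?_
    have hs : 0 ≤ s := interior_subset hs
    have hsq := sq_nonneg ‖x s‖
    have hdecr := mul_nonneg hs (neg_nonneg.mpr (hxy s hs))
    simp only [id_eq]
    linarith [hxyz s hs]
  have hle := hanti self_mem_Ici ht ht
  simp only [zero_mul, zero_add] at hle
  have : 0 ≤ C * (‖x t‖ ^ 2 + ‖y t‖ ^ 2) := by positivity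
  linarith

theorem IsSolutionFamily.conj {X Y : Type*} [NormedAddCommGroup X] [NormedSpace ℝ X]
    [NormedAddCommGroup Y] [NormedSpace ℝ Y] {A : Submodule ℝ (Y × Y)} (e : Y ≃L[ℝ] X)
    {S : ℝ → X → X}
    (hS : IsSolutionFamily (A.map ((e.prodCongr e).toLinearEquiv : Y × Y →ₗ[ℝ] X × X)) S) :
    IsSolutionFamily A fun t y => e.symm (S t (e y)) where
  zero_apply y := by simp [hS.zero_apply]
  continuous_orbit y := e.symm.continuous.comp (hS.continuous_orbit (e y))
  mem h _ ht := (Submodule.mem_map_equiv _).mp (hS.mem (Submodule.mem_map_of_mem h) ht)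
  hasDerivWithinAt {x y} h t ht :=
    (e.symm : X →L[ℝ] Y).hasFDerivAt.comp_hasDerivWithinAt t
      (hS.hasDerivWithinAt (Submodule.mem_map_of_mem h) ht)

/-- Generation in a Banach space `X` carrying an equivalent Hilbert norm `‖Φ x‖` for which the
operator is dissipative. -/
theorem exists_isSolutionFamily_of_antilipschitz {X : Type*} [NormedAddCommGroup X]
    [NormedSpace ℝ X] [CompleteSpace X] [CompleteSpace H] {Φ : X →L[ℝ] H} {c : NNReal}
    (hΦ : AntilipschitzWith c Φ) {A : Submodule ℝ (X × X)}
    (dissip : ∀ {x y}, (x, y) ∈ A → inner ℝ (Φ x) (Φ y) ≤ 0)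
    (single : ∀ {y}, (0, y) ∈ A → y = 0)
    (surj : ∀ l : ℝ, 0 < l → ∀ f, ∃ x y, (x, y) ∈ A ∧ l • x - y = f) :
    ∃ S, IsSolutionFamily A S := by
  have hclosed : IsClosed (range Φ) := hΦ.isClosed_range Φ.uniformContinuous
  have : CompleteSpace Φ.range := IsClosed.completeSpace_coe (hs := hclosed)
  let e : X ≃L[ℝ] Φ.range := ContinuousLinearMap.equivRange hΦ.injective hclosed
  have hA : IsMDissipative
      (A.map ((e.prodCongr e).toLinearEquiv : X × X →ₗ[ℝ] Φ.range × Φ.range)) := by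
    refine .of_inner_nonpos ?_ ?_ fun l hl f => ?_
    · rintro _ _ ⟨⟨x, y⟩, hxy, ⟨⟩⟩
      exact dissip hxy
    · intro y hy
      rw [Submodule.mem_map_equiv] at hy
      exact e.symm.map_eq_zero_iff.mp (single (by simpa using hy))
    · obtain ⟨x, y, hxy, hf⟩ := surj l hl (e.symm f)
      exact ⟨e x, e y, Submodule.mem_map_of_mem hxy, by
        rw [← map_smul, ← map_sub, hf, e.apply_symm_apply]⟩
  obtain ⟨S, hS⟩ := hA.exists_isSolutionFamily
  exact ⟨_, hS.conj e⟩

end Dissipative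

section Orbit

variable {X : Type*} [NormedAddCommGroup X] [NormedSpace ℝ X] {A : Submodule ℝ (X × X)}
  {S : ℝ → X → X} {x : X}

/-- The domain of the `k`-th power of the operator with graph `A`. -/
def powDomain (A : Submodule ℝ (X × X)) : ℕ → Set X
  | 0 => univ
  | k + 1 => {x | ∃ y ∈ powDomain A k, (x, y) ∈ A}

theorem IsSolutionFamily.derivWithin (hS : IsSolutionFamily A S) {y : X} (h : (x, y) ∈ A) :
    EqOn (derivWithin (fun t => S t x) (Ici 0)) (fun t => S t y) (Ici 0) := fun t ht =>
  (hS.hasDerivWithinAt h ht).derivWithin (uniqueDiffOn_Ici 0 t ht)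

theorem IsSolutionFamily.contDiffOn (hS : IsSolutionFamily A S) {k : ℕ}
    (hx : x ∈ powDomain A k) : ContDiffOn ℝ k (fun t => S t x) (Ici 0) := by
  induction k generalizing x with
  | zero => exact contDiffOn_zero.mpr (hS.continuous_orbit x).continuousOn
  | succ k ih =>
    obtain ⟨y, hy, hxy⟩ := hx
    rw [Nat.cast_add, Nat.cast_one, contDiffOn_succ_iff_derivWithin (uniqueDiffOn_Ici 0)]
    exact ⟨fun t ht => (hS.hasDerivWithinAt hxy ht).differentiableWithinAt,
      by simp, (ih hy).congr (hS.derivWithin hxy)⟩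

theorem IsSolutionFamily.exists_iteratedDerivWithin_eqOn (hS : IsSolutionFamily A S) {k j : ℕ}
    (hx : x ∈ powDomain A (k + j)) : ∃ y ∈ powDomain A j,
      EqOn (iteratedDerivWithin k (fun t => S t x) (Ici 0)) (fun t => S t y) (Ici 0) := by
  induction k generalizing x with
  | zero => exact ⟨x, by simpa using hx, fun t _ => by rw [iteratedDerivWithin_zero]⟩
  | succ k ih =>
    rw [Nat.succ_add] at hx
    obtain ⟨x', hx', hmem⟩ := hx
    obtain ⟨y, hy, heq⟩ := ih hx'
    refine ⟨y, hy, fun t ht => ?_⟩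
    rw [iteratedDerivWithin_succ', iteratedDerivWithin_congr (hS.derivWithin hmem) ht]
    exact heq ht

variable {H : Type*} [NormedAddCommGroup H] [InnerProductSpace ℝ H] {Φ : X →L[ℝ] H}

theorem IsSolutionFamily.mul_norm_sq_iteratedDerivWithin_le (hS : IsSolutionFamily A S) {C : ℝ}
    (hC : 0 ≤ C) (dissip : ∀ {x y}, (x, y) ∈ A → inner ℝ (Φ x) (Φ y) ≤ 0)
    (control : ∀ {x y z}, (x, y) ∈ A → (y, z) ∈ A →
      ‖Φ x‖ ^ 2 ≤ C * (-inner ℝ (Φ x) (Φ y) - inner ℝ (Φ y) (Φ z)))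
    {k : ℕ} (hx : x ∈ powDomain A (k + 2)) {t : ℝ} (ht : 0 ≤ t) :
    t * ‖Φ (iteratedDerivWithin k (fun s => S s x) (Ici 0) t)‖ ^ 2
      ≤ C * (‖Φ (iteratedDerivWithin k (fun s => S s x) (Ici 0) 0)‖ ^ 2
        + ‖Φ (iteratedDerivWithin (k + 1) (fun s => S s x) (Ici 0) 0)‖ ^ 2) := by
  obtain ⟨u, ⟨v, ⟨w, -, hvw⟩, huv⟩, hk⟩ := hS.exists_iteratedDerivWithin_eqOn hx
  have hk_succ : iteratedDerivWithin (k + 1) (fun s => S s x) (Ici 0) 0 = S 0 v := by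
    rw [iteratedDerivWithin_succ, derivWithin_congr hk (hk self_mem_Ici),
      hS.derivWithin huv self_mem_Ici]
  rw [hk ht, hk self_mem_Ici, hk_succ]
  exact mul_norm_sq_le_of_norm_sq_le_dissipation hC
    (fun s hs => Φ.hasFDerivAt.comp_hasDerivWithinAt s (hS.hasDerivWithinAt huv hs))
    (fun s hs => Φ.hasFDerivAt.comp_hasDerivWithinAt s (hS.hasDerivWithinAt hvw hs))
    (fun s hs => dissip (hS.mem huv hs)) (fun s hs => control (hS.mem huv hs) (hS.mem hvw hs)) ht

theorem eqOn_of_inner_nonpos (hΦ : Function.Injective Φ)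
    (dissip : ∀ {x y}, (x, y) ∈ A → inner ℝ (Φ x) (Φ y) ≤ 0) {f g f' g' : ℝ → X}
    (hf : ∀ t, 0 ≤ t → (f t, f' t) ∈ A ∧ HasDerivWithinAt f (f' t) (Ici 0) t)
    (hg : ∀ t, 0 ≤ t → (g t, g' t) ∈ A ∧ HasDerivWithinAt g (g' t) (Ici 0) t)
    (h0 : f 0 = g 0) : EqOn f g (Ici 0) := by
  intro t ht
  have hle := norm_sq_antitoneOn (f := fun t => Φ (f t - g t)) (f' := fun t => Φ (f' t - g' t))
    (fun s hs => Φ.hasFDerivAt.comp_hasDerivWithinAt s ((hf s hs).2.sub (hg s hs).2))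
    (fun s hs => dissip (A.sub_mem (hf s hs).1 (hg s hs).1)) self_mem_Ici ht ht
  simp only [h0, sub_self, map_zero, norm_zero, zero_pow two_ne_zero] at hle
  exact sub_eq_zero.mp ((map_eq_zero_iff Φ hΦ).mp (norm_eq_zero.mp (sq_nonpos_iff _ |>.mp hle)))

end Orbit

section Primitive

variable {E F G : Type*} [NormedAddCommGroup E] [NormedSpace ℝ E] [NormedAddCommGroup F]
  [NormedSpace ℝ F] [NormedAddCommGroup G] [NormedSpace ℝ G] {L : ℝ}

-- Fubini on the two halves of the square cut by the diagonal.
theorem integral_bilin_setIntegral_Iic_add [CompleteSpace E] [CompleteSpace F] [CompleteSpace G]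
    {μ : Measure ℝ} [SFinite μ] (B : E →L[ℝ] F →L[ℝ] G) {a : ℝ → E} {b : ℝ → F}
    (ha : Integrable a μ) (hb : Integrable b μ) :
    (∫ x, B (a x) (∫ y in Iic x, b y ∂μ) ∂μ) + ∫ y, B (∫ x in Iio y, a x ∂μ) (b y) ∂μ
      = B (∫ x, a x ∂μ) (∫ y, b y ∂μ) := by
  let s : Set (ℝ × ℝ) := {z | z.2 ≤ z.1}
  have hs : MeasurableSet s := measurableSet_le measurable_snd measurable_fst
  let f : ℝ × ℝ → G := fun z => B (a z.1) (b z.2)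
  have hf : Integrable f (μ.prod μ) :=
    ha.op_fst_snd (op := fun u v => B u v) (by fun_prop) ⟨‖B‖, B.le_opNorm₂⟩ hb
  have lower : ∫ x, B (a x) (∫ y in Iic x, b y ∂μ) ∂μ = ∫ z in s, f z ∂(μ.prod μ) := by
    rw [← integral_indicator hs, integral_prod _ (hf.indicator hs)]
    refine integral_congr_ae (Eventually.of_forall fun x => ?_)
    simp only [← (B (a x)).integral_comp_comm hb.integrableOn]
    exact (integral_indicator measurableSet_Iic).symm
  have upper : ∫ y, B (∫ x in Iio y, a x ∂μ) (b y) ∂μ = ∫ z in sᶜ, f z ∂(μ.prod μ) := by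
    rw [← integral_indicator hs.compl, integral_prod_symm _ (hf.indicator hs.compl)]
    refine integral_congr_ae (Eventually.of_forall fun y => ?_)
    simp only [← B.flip_apply, ← (B.flip (b y)).integral_comp_comm ha.integrableOn]
    rw [← integral_indicator measurableSet_Iio]
    refine integral_congr_ae (Eventually.of_forall fun x => ?_)
    simp only [indicator, mem_Iio, mem_compl_iff, s, mem_ofPred_eq, not_le, f,
      ContinuousLinearMap.flip_apply]
  rw [lower, upper, integral_add_compl hs hf, integral_prod_bilin B ha hb]

/-- The primitive of `b` on `(0, L)` that vanishes at `0`, extended by constants to the line. -/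
def prim (L : ℝ) (b : ℝ → E) (x : ℝ) : E := ∫ y in Iic x, b y ∂(volume.restrict (Ioo 0 L))

theorem continuous_prim {b : ℝ → E} (hb : Integrable b (volume.restrict (Ioo 0 L))) :
    Continuous (prim L b) := by
  have h : prim L b
      = fun x => prim L b 0 + ∫ y in (0 : ℝ)..x, b y ∂(volume.restrict (Ioo 0 L)) := by
    funext x
    rw [← intervalIntegral.integral_Iic_sub_Iic hb.integrableOn hb.integrableOn]
    exact (add_sub_cancel _ _).symm
  rw [h]
  exact continuous_const.add (hb.continuous_primitive 0)

@[simp] theorem prim_left (b : ℝ → E) : prim L b 0 = 0 := by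
  have h : Iic 0 ∩ Ioo 0 L = ∅ := by
    ext y
    simp only [mem_inter_iff, mem_Iic, mem_Ioo, mem_empty_iff_false, iff_false]
    exact fun hy => hy.1.not_gt hy.2.1
  rw [prim, Measure.restrict_restrict measurableSet_Iic, h, setIntegral_empty]

@[simp] theorem prim_right (b : ℝ → E) : prim L b L = ∫ y in Ioo 0 L, b y := by
  rw [prim, Measure.restrict_restrict measurableSet_Iic,
    inter_eq_right.mpr (Ioo_subset_Iio_self.trans Iio_subset_Iic_self)]

theorem integrable_prim {b : ℝ → E} (hb : Integrable b (volume.restrict (Ioo 0 L))) :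
    Integrable (prim L b) (volume.restrict (Ioo 0 L)) :=
  ((continuous_prim hb).integrableOn_Icc (a := 0) (b := L)).mono_set Ioo_subset_Icc_self

theorem integral_bilin_prim_add [CompleteSpace E] [CompleteSpace F] [CompleteSpace G]
    (B : E →L[ℝ] F →L[ℝ] G) {a : ℝ → E} {b : ℝ → F}
    (ha : Integrable a (volume.restrict (Ioo 0 L)))
    (hb : Integrable b (volume.restrict (Ioo 0 L))) :
    (∫ x in Ioo 0 L, B (a x) (prim L b x)) + ∫ x in Ioo 0 L, B (prim L a x) (b x)
      = B (∫ x in Ioo 0 L, a x) (∫ x in Ioo 0 L, b x) := by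
  rw [← integral_bilin_setIntegral_Iic_add B ha hb]
  simp only [prim, setIntegral_congr_set (Iio_ae_eq_Iic (μ := volume.restrict (Ioo 0 L)))]

end Primitive

/-- Test functions of class `C_c^∞(0, L)`, as functions on the line. -/
structure IsTestFunction (L : ℝ) (φ : ℝ → ℝ) : Prop where
  contDiff : ContDiff ℝ ∞ φ
  hasCompactSupport : HasCompactSupport φ
  tsupport_subset : tsupport φ ⊆ Ioo 0 L

namespace IsTestFunction

variable {E : Type*} [NormedAddCommGroup E] [NormedSpace ℝ E] {L : ℝ} {φ ψ : ℝ → ℝ}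

theorem continuous (hφ : IsTestFunction L φ) : Continuous φ := hφ.contDiff.continuous

theorem integrable (hφ : IsTestFunction L φ) : Integrable φ (volume.restrict (Ioo 0 L)) :=
  (hφ.continuous.integrable_of_hasCompactSupport hφ.hasCompactSupport).integrableOn

theorem integrable_smul (hφ : IsTestFunction L φ) {f : ℝ → E}
    (hf : Integrable f (volume.restrict (Ioo 0 L))) :
    Integrable (fun x => φ x • f x) (volume.restrict (Ioo 0 L)) := by
  obtain ⟨K, hK⟩ := hφ.hasCompactSupport.exists_bound_of_continuous hφ.continuous
  exact hf.bdd_smul K hφ.continuous.aestronglyMeasurable (Eventually.of_forall hK)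

theorem eq_zero_of_notMem (hφ : IsTestFunction L φ) {x : ℝ} (hx : x ∉ Ioo 0 L) : φ x = 0 :=
  image_eq_zero_of_notMem_tsupport fun h => hx (hφ.tsupport_subset h)

theorem setIntegral_smul (hφ : IsTestFunction L φ) (f : ℝ → E) :
    ∫ x in Ioo 0 L, φ x • f x = ∫ x, φ x • f x :=
  setIntegral_eq_integral_of_forall_compl_eq_zero fun x hx => by
    rw [hφ.eq_zero_of_notMem hx, zero_smul]

theorem sub_const_mul (hφ : IsTestFunction L φ) (k : ℝ) (hψ : IsTestFunction L ψ) :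
    IsTestFunction L fun x => φ x - k * ψ x where
  contDiff := hφ.contDiff.sub (contDiff_const.mul hψ.contDiff)
  hasCompactSupport := hφ.hasCompactSupport.sub hψ.hasCompactSupport.mul_left
  tsupport_subset := (tsupport_sub φ fun x => k * ψ x).trans
    (union_subset hφ.tsupport_subset (tsupport_mul_subset_right.trans hψ.tsupport_subset))

theorem derivative (hφ : IsTestFunction L φ) : IsTestFunction L (deriv φ) where
  contDiff := (contDiff_infty_iff_deriv.mp hφ.contDiff).2
  hasCompactSupport := hφ.hasCompactSupport.deriv
  tsupport_subset := tsupport_deriv_subset.trans hφ.tsupport_subset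

theorem prim_deriv (hφ : IsTestFunction L φ) (x : ℝ) : prim L (deriv φ) x = φ x := by
  rw [prim, Measure.restrict_restrict measurableSet_Iic, ←
    hφ.hasCompactSupport.integral_Iic_deriv_eq (hφ.contDiff.of_le (by simp)) x]
  refine (setIntegral_eq_of_subset_of_forall_sdiff_eq_zero measurableSet_Iic inter_subset_left
    fun y hy => ?_).symm
  exact hφ.derivative.eq_zero_of_notMem fun hy' => hy.2 ⟨hy.1, hy'⟩

theorem integral_deriv (hφ : IsTestFunction L φ) :
    ∫ x in Ioo 0 L, deriv φ x = 0 := by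
  rw [← prim_right, hφ.prim_deriv, hφ.eq_zero_of_notMem right_notMem_Ioo]

end IsTestFunction

theorem exists_isTestFunction_integral_eq_one {L : ℝ} (hL : 0 < L) :
    ∃ ψ, IsTestFunction L ψ ∧ ∫ x in Ioo 0 L, ψ x = 1 := by
  let B : ContDiffBump (L / 2) := ⟨L / 8, L / 4, by positivity, by linarith⟩
  have hB : IsTestFunction L (B.normed volume) := by
    refine ⟨B.contDiff_normed, B.hasCompactSupport_normed, ?_⟩
    rw [B.tsupport_normed_eq, Real.closedBall_eq_Icc]
    exact Icc_subset_Ioo (by change 0 < L / 2 - L / 4; linarith)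
      (by change L / 2 + L / 4 < L; linarith)
  refine ⟨B.normed volume, hB, ?_⟩
  simpa only [smul_eq_mul, mul_one, B.integral_normed] using hB.setIntegral_smul fun _ => (1 : ℝ)

theorem exists_Icc_superset_of_subset_Ioo {K : Set ℝ} {u v : ℝ} (hK : IsCompact K)
    (huv : u < v) (h : K ⊆ Ioo u v) : ∃ a b, u < a ∧ b < v ∧ K ⊆ Icc a b := by
  rcases K.eq_empty_or_nonempty with rfl | hne
  · exact ⟨v, u, huv, huv, empty_subset _⟩
  · exact ⟨sInf K, sSup K, (h (hK.sInf_mem hne)).1, (h (hK.sSup_mem hne)).2,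
      subset_Icc_csInf_csSup hK.bddBelow hK.bddAbove⟩

theorem IsTestFunction.exists_deriv_eq {L : ℝ} {h : ℝ → ℝ} (hL : 0 < L) (hh : IsTestFunction L h)
    (h0 : ∫ x in Ioo 0 L, h x = 0) : ∃ χ, IsTestFunction L χ ∧ deriv χ = h := by
  obtain ⟨a, b, ha, hb, hab⟩ :=
    exists_Icc_superset_of_subset_Ioo hh.hasCompactSupport.isCompact hL hh.tsupport_subset
  have vanish : ∀ y ∉ Icc a b, h y = 0 := fun y hy =>
    image_eq_zero_of_notMem_tsupport fun hy' => hy (hab hy')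
  let χ : ℝ → ℝ := fun x => ∫ y in (0 : ℝ)..x, h y
  have hder : ∀ x, HasDerivAt χ (h x) x := fun x =>
    (hh.continuous.integral_hasStrictDerivAt 0 x).hasDerivAt
  have hχ : deriv χ = h := funext fun x => (hder x).deriv
  have total : ∀ s, Icc a b ⊆ s → ∫ y in s, h y = ∫ y, h y := fun s hs =>
    setIntegral_eq_integral_of_forall_compl_eq_zero fun y hy => vanish y fun hy' => hy (hs hy')
  have hsupp : Function.support χ ⊆ Icc a b := by
    refine Function.support_subset_iff'.mpr fun x hx => ?_
    rcases lt_or_ge x a with hxa | hxa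
    · refine intervalIntegral.integral_zero_ae (Eventually.of_forall fun y hy => vanish y ?_)
      exact fun hy' => hy'.1.not_gt (hy.2.trans_lt (max_lt ha hxa))
    · have hbx : b < x := not_le.mp fun hxb => hx ⟨hxa, hxb⟩
      change ∫ y in (0 : ℝ)..x, h y = 0
      rw [intervalIntegral.integral_of_le (ha.le.trans hxa),
        total (Ioc 0 x) fun y hy => ⟨ha.trans_le hy.1, hy.2.trans hbx.le⟩,
        ← total _ (Icc_subset_Ioo ha hb), h0]
  refine ⟨χ, ⟨?_, HasCompactSupport.of_support_subset_isCompact isCompact_Icc hsupp,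
    (closure_minimal hsupp isClosed_Icc).trans (Icc_subset_Ioo ha hb)⟩, hχ⟩
  rw [contDiff_infty_iff_deriv, hχ]
  exact ⟨fun x => (hder x).differentiableAt, hh.contDiff⟩

theorem hasWeakDeriv_prim {E : Type*} [NormedAddCommGroup E] [NormedSpace ℝ E] [CompleteSpace E]
    {L : ℝ} {g : ℝ → E} (hg : Integrable g (volume.restrict (Ioo 0 L))) :
    HasWeakDeriv L (prim L g) g := by
  intro φ hφ hc hs
  have hφ : IsTestFunction L φ := ⟨hφ, hc, hs⟩
  have parts := integral_bilin_prim_add (.lsmul ℝ ℝ) hφ.derivative.integrable hg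
  simp only [ContinuousLinearMap.lsmul_apply, hφ.prim_deriv, hφ.integral_deriv, zero_smul] at parts
  exact eq_neg_of_add_eq_zero_left parts

namespace HasWeakDeriv

variable {E : Type*} [NormedAddCommGroup E] [NormedSpace ℝ E] {L : ℝ} {f g : ℝ → E}

theorem apply (h : HasWeakDeriv L f g) {φ : ℝ → ℝ} (hφ : IsTestFunction L φ) :
    ∫ x in Ioo 0 L, deriv φ x • f x = -∫ x in Ioo 0 L, φ x • g x :=
  h φ hφ.contDiff hφ.hasCompactSupport hφ.tsupport_subset

theorem congr {f' g' : ℝ → E} (h : HasWeakDeriv L f g)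
    (hf : f =ᵐ[volume.restrict (Ioo 0 L)] f') (hg : g =ᵐ[volume.restrict (Ioo 0 L)] g') :
    HasWeakDeriv L f' g' := by
  intro φ hφ hc hs
  have ef : ∫ x in Ioo 0 L, deriv φ x • f' x = ∫ x in Ioo 0 L, deriv φ x • f x :=
    integral_congr_ae (hf.mono fun x hx => by simp only [hx])
  have eg : ∫ x in Ioo 0 L, φ x • g' x = ∫ x in Ioo 0 L, φ x • g x :=
    integral_congr_ae (hg.mono fun x hx => by simp only [hx])
  rw [ef, eg, h φ hφ hc hs]

variable [CompleteSpace E]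

theorem ae_eq_const (hL : 0 < L) (hf : Integrable f (volume.restrict (Ioo 0 L)))
    (h : HasWeakDeriv L f fun _ => 0) :
    ∃ c, f =ᵐ[volume.restrict (Ioo 0 L)] fun _ => c := by
  obtain ⟨ψ, hψ, hψ1⟩ := exists_isTestFunction_integral_eq_one hL
  let c : E := ∫ x in Ioo 0 L, ψ x • f x
  -- A test function differs from a multiple of `ψ` by the derivative of a test function.
  have proportional : ∀ φ, IsTestFunction L φ →
      ∫ x in Ioo 0 L, φ x • f x = (∫ x in Ioo 0 L, φ x) • c := by
    intro φ hφ
    set k : ℝ := ∫ x in Ioo 0 L, φ x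
    obtain ⟨χ, hχ, hχφ⟩ := (hφ.sub_const_mul k hψ).exists_deriv_eq hL (by
      rw [integral_sub hφ.integrable (hψ.integrable.const_mul k), integral_const_mul, hψ1, mul_one,
        sub_self])
    have orth := h.apply hχ
    simp only [hχφ, sub_smul, mul_smul, smul_zero, integral_zero, neg_zero] at orth
    rwa [integral_sub (hφ.integrable_smul hf) (by exact (hψ.integrable_smul hf).smul k),
      integral_smul, sub_eq_zero] at orth
  have hfc : Integrable (fun x => f x - c) (volume.restrict (Ioo 0 L)) :=
    hf.sub (integrable_const c)
  have hzero : ∀ᵐ x ∂volume, x ∈ Ioo 0 L → f x - c = 0 := by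
    refine isOpen_Ioo.ae_eq_zero_of_integral_contDiff_smul_eq_zero
      (IntegrableOn.locallyIntegrableOn hfc) fun φ hφ hφc hφs => ?_
    have hφ : IsTestFunction L φ := ⟨hφ, hφc, hφs⟩
    rw [← hφ.setIntegral_smul]
    simp only [smul_sub]
    rw [integral_sub (hφ.integrable_smul hf) (hφ.integrable.smul_const c), integral_smul_const,
      proportional φ hφ, sub_self]
  refine ⟨c, ?_⟩
  filter_upwards [ae_restrict_of_ae hzero, ae_restrict_mem measurableSet_Ioo] with x hx hxL
  exact sub_eq_zero.mp (hx hxL)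

theorem exists_ae_eq_const_add_prim (hL : 0 < L) (hf : Integrable f (volume.restrict (Ioo 0 L)))
    (hg : Integrable g (volume.restrict (Ioo 0 L))) (h : HasWeakDeriv L f g) :
    ∃ c, f =ᵐ[volume.restrict (Ioo 0 L)] fun x => c + prim L g x := by
  have hdiff : HasWeakDeriv L (fun x => f x - prim L g x) fun _ => (0 : E) := by
    intro φ hφ hc hs
    have hφ : IsTestFunction L φ := ⟨hφ, hc, hs⟩
    simp only [smul_sub, smul_zero, integral_zero, neg_zero]
    rw [integral_sub (hφ.derivative.integrable_smul hf)
      (hφ.derivative.integrable_smul (integrable_prim hg)), h.apply hφ,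
      (hasWeakDeriv_prim hg).apply hφ, sub_self]
  obtain ⟨c, hc⟩ := hdiff.ae_eq_const hL (hf.sub (integrable_prim hg))
  exact ⟨c, hc.mono fun x hx => sub_eq_iff_eq_add.mp hx⟩

end HasWeakDeriv

section L2Operators

variable {𝕜 : Type*} [RCLike 𝕜] {L : ℝ}

theorem L2.integrable (f : L2 𝕜 L) : Integrable f (volume.restrict (Ioo 0 L)) :=
  (Lp.memLp f).integrable one_le_two

theorem norm_setIntegral_le_sqrt_mul_norm {α : Type*} [MeasurableSpace α] {μ : Measure α}
    [IsFiniteMeasure μ] (f : Lp 𝕜 2 μ) {s : Set α} (hs : MeasurableSet s) :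
    ‖∫ x in s, f x ∂μ‖ ≤ √(μ.real univ) * ‖f‖ := by
  rw [← L2.inner_indicatorConstLp_one (𝕜 := 𝕜) hs (measure_ne_top μ s) f]
  refine (norm_inner_le_norm _ _).trans (mul_le_mul_of_nonneg_right ?_ (norm_nonneg f))
  rw [norm_indicatorConstLp (by norm_num) (by norm_num), norm_one, one_mul, ENNReal.toReal_ofNat,
    ← Real.sqrt_eq_rpow]
  exact Real.sqrt_le_sqrt (measureReal_mono (subset_univ s))

/-- The integral over `(0, L)` as a functional on `L²(0, L)`. -/
def mean (𝕜 : Type*) [RCLike 𝕜] (L : ℝ) : L2 𝕜 L →L[ℝ] 𝕜 :=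
  (innerSL 𝕜 (indicatorConstLp 2 MeasurableSet.univ
    (measure_ne_top (volume.restrict (Ioo 0 L)) univ) 1)).restrictScalars ℝ

theorem mean_apply (f : L2 𝕜 L) : mean 𝕜 L f = ∫ x in Ioo 0 L, f x := by
  rw [mean, ContinuousLinearMap.coe_restrictScalars', innerSL_apply_apply,
    L2.inner_indicatorConstLp_one, setIntegral_univ]

theorem memLp_prim (f : L2 𝕜 L) : MemLp (prim L f) 2 (volume.restrict (Ioo 0 L)) :=
  MemLp.of_bound (continuous_prim (L2.integrable f)).aestronglyMeasurable
    (√((volume.restrict (Ioo 0 L)).real univ) * ‖f‖)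
    (Eventually.of_forall fun _ => norm_setIntegral_le_sqrt_mul_norm f measurableSet_Iic)

/-- The primitive vanishing at `0` as a bounded operator on `L²(0, L)`. -/
def volterra (𝕜 : Type*) [RCLike 𝕜] (L : ℝ) : L2 𝕜 L →L[ℝ] L2 𝕜 L :=
  LinearMap.mkContinuousOfExistsBound
    { toFun := fun f => (memLp_prim f).toLp
      map_add' := fun f g => by
        rw [← MemLp.toLp_add]
        refine MemLp.toLp_congr _ _ (Eventually.of_forall fun x => ?_)
        rw [Pi.add_apply, prim, prim, prim,
          ← integral_add (L2.integrable f).restrict (L2.integrable g).restrict]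
        exact integral_congr_ae (ae_restrict_of_ae (Lp.coeFn_add f g))
      map_smul' := fun c f => by
        rw [RingHom.id_apply, ← MemLp.toLp_const_smul]
        refine MemLp.toLp_congr _ _ (Eventually.of_forall fun x => ?_)
        rw [Pi.smul_apply, prim, prim, ← integral_smul]
        exact integral_congr_ae (ae_restrict_of_ae (Lp.coeFn_smul c f)) }
    (by
      set μ := volume.restrict (Ioo 0 L)
      refine ⟨(measureUnivNNReal μ : ℝ) ^ (2 : ℝ≥0∞).toReal⁻¹ * √(μ.real univ), fun f => ?_⟩
      rw [mul_assoc]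
      refine Lp.norm_le_of_ae_bound (by positivity) ?_
      filter_upwards [MemLp.coeFn_toLp (memLp_prim f)] with x hx
      exact (congrArg norm hx).le.trans (norm_setIntegral_le_sqrt_mul_norm f measurableSet_Iic))

theorem volterra_coeFn (f : L2 𝕜 L) :
    volterra 𝕜 L f =ᵐ[volume.restrict (Ioo 0 L)] prim L f :=
  MemLp.coeFn_toLp (memLp_prim f)

theorem inner_volterra_add (f g : L2 𝕜 L) :
    inner ℝ f (volterra 𝕜 L g) + inner ℝ (volterra 𝕜 L f) g
      = inner ℝ (mean 𝕜 L f) (mean 𝕜 L g) := by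
  have parts : (∫ x in Ioo 0 L, inner ℝ (f x) (prim L g x))
      + ∫ x in Ioo 0 L, inner ℝ (prim L f x) (g x)
      = inner ℝ (∫ x in Ioo 0 L, f x) (∫ x in Ioo 0 L, g x) :=
    integral_bilin_prim_add (innerSL ℝ) (L2.integrable f) (L2.integrable g)
  rw [mean_apply, mean_apply, ← parts, L2.inner_def, L2.inner_def]
  congr 1
  · exact integral_congr_ae ((volterra_coeFn g).mono fun x hx => by simp only [hx])
  · exact integral_congr_ae ((volterra_coeFn f).mono fun x hx => by simp only [hx])

theorem HasWeakDeriv.exists_ae_eq_const_add_volterra (hL : 0 < L) {f g : L2 𝕜 L}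
    (h : HasWeakDeriv L f g) :
    ∃ c, ∀ᵐ x ∂(volume.restrict (Ioo 0 L)), f x = c + volterra 𝕜 L g x := by
  obtain ⟨c, hc⟩ := h.exists_ae_eq_const_add_prim hL (L2.integrable f) (L2.integrable g)
  refine ⟨c, ?_⟩
  filter_upwards [hc, volterra_coeFn g] with x hf hg
  rw [hf, hg]

end L2Operators

section Sobolev

variable {𝕜 : Type*} [RCLike 𝕜] {L : ℝ}

theorem mem_H10_of_eq_volterra {v : L2 𝕜 L × L2 𝕜 L} (h : v.1 = volterra 𝕜 L v.2)
    (h0 : mean 𝕜 L v.2 = 0) : v ∈ H10 𝕜 L := by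
  have hae : v.1 =ᵐ[volume.restrict (Ioo 0 L)] prim L v.2 := h ▸ volterra_coeFn v.2
  refine ⟨(hasWeakDeriv_prim (L2.integrable v.2)).congr hae.symm EventuallyEq.rfl,
    prim L v.2, (continuous_prim (L2.integrable v.2)).continuousOn, prim_left _, ?_, hae⟩
  rw [prim_right, ← mean_apply, h0]

theorem eq_volterra_of_mem_H10 (hL : 0 < L) {v : L2 𝕜 L × L2 𝕜 L} (hv : v ∈ H10 𝕜 L) :
    v.1 = volterra 𝕜 L v.2 ∧ mean 𝕜 L v.2 = 0 := by
  obtain ⟨hder, r, hr, hr0, hrL, hvr⟩ := hv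
  obtain ⟨c, hc⟩ := hder.exists_ae_eq_const_add_volterra hL
  have hcont : Continuous fun x => c + prim L v.2 x :=
    continuous_const.add (continuous_prim (L2.integrable v.2))
  have hae : r =ᵐ[volume.restrict (Icc 0 L)] fun x => c + prim L v.2 x := by
    rw [← restrict_Ioo_eq_restrict_Icc]
    filter_upwards [hvr, hc, volterra_coeFn v.2] with x h1 h2 h3
    rw [← h1, h2, h3]
  have heq := Measure.eqOn_Icc_of_ae_eq volume hL.ne hae hr hcont.continuousOn
  have hc0 : c = 0 := by simpa [hr0] using (heq (left_mem_Icc.mpr hL.le)).symm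
  refine ⟨Lp.ext (hc.mono fun x hx => by rw [hx, hc0, zero_add]), ?_⟩
  simpa [hrL, hc0, mean_apply] using (heq (right_mem_Icc.mpr hL.le)).symm

theorem fn_eq_volterra (hL : 0 < L) (u : H10 𝕜 L) : fn u = volterra 𝕜 L (dx u) :=
  (eq_volterra_of_mem_H10 hL u.2).1

theorem mean_dx (hL : 0 < L) (u : H10 𝕜 L) : mean 𝕜 L (dx u) = 0 :=
  (eq_volterra_of_mem_H10 hL u.2).2

theorem H10.ext_dx (hL : 0 < L) {u v : H10 𝕜 L} (h : dx u = dx v) : u = v := by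
  refine Subtype.ext (Prod.ext ?_ h)
  exact (fn_eq_volterra hL u).trans ((congrArg _ h).trans (fn_eq_volterra hL v).symm)

/-- The element of `H¹₀(0, L)` with a given weak derivative of zero mean. -/
def ofDeriv (v : L2 𝕜 L) (hv : mean 𝕜 L v = 0) : H10 𝕜 L :=
  ⟨(volterra 𝕜 L v, v), mem_H10_of_eq_volterra rfl hv⟩

theorem isClosed_H10 (hL : 0 < L) : IsClosed (H10 𝕜 L : Set (L2 𝕜 L × L2 𝕜 L)) := by
  have h : (H10 𝕜 L : Set (L2 𝕜 L × L2 𝕜 L))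
      = {v | v.1 = volterra 𝕜 L v.2} ∩ {v | mean 𝕜 L v.2 = 0} := by
    ext v
    exact ⟨eq_volterra_of_mem_H10 hL, fun hv => mem_H10_of_eq_volterra hv.1 hv.2⟩
  rw [h]
  exact (isClosed_eq continuous_fst (by fun_prop)).inter
    (isClosed_eq (by fun_prop) continuous_const)

theorem HasWeakDeriv.inner_dx_eq_neg_inner_fn (hL : 0 < L) {f g : L2 𝕜 L}
    (h : HasWeakDeriv L f g) (u : H10 𝕜 L) : inner ℝ (dx u) f = -inner ℝ (fn u) g := by
  obtain ⟨c, hc⟩ := h.exists_ae_eq_const_add_volterra hL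
  have hconst : inner ℝ (dx u) (f - volterra 𝕜 L g) = inner ℝ c (mean 𝕜 L (dx u)) := by
    rw [L2.inner_def, mean_apply, ← integral_inner (L2.integrable (dx u))]
    refine integral_congr_ae ?_
    filter_upwards [hc, Lp.coeFn_sub f (volterra 𝕜 L g)] with x hx hsub
    rw [hsub, Pi.sub_apply, hx, add_sub_cancel_right, real_inner_comm]
  have parts := inner_volterra_add (dx u) g
  rw [mean_dx hL, inner_zero_left, ← fn_eq_volterra hL] at parts
  rw [mean_dx hL, inner_zero_right, inner_sub_right] at hconst
  linarith

namespace IsTestFunction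

variable {φ : ℝ → ℝ}

theorem memLp_smul_const (hφ : IsTestFunction L φ) (c : 𝕜) :
    MemLp (fun x => φ x • c) 2 (volume.restrict (Ioo 0 L)) :=
  ((hφ.continuous.smul continuous_const).memLp_of_hasCompactSupport
    hφ.hasCompactSupport.smul_right).restrict _

theorem inner_eq_of_ae_eq (hφ : IsTestFunction L φ) {c : 𝕜} {v : L2 𝕜 L}
    (hv : v =ᵐ[volume.restrict (Ioo 0 L)] fun x => φ x • c) (g : L2 𝕜 L) :
    inner ℝ v g = inner ℝ c (∫ x in Ioo 0 L, φ x • g x) := by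
  rw [L2.inner_def, ← integral_inner (hφ.integrable_smul (L2.integrable g))]
  refine integral_congr_ae (hv.mono fun x hx => ?_)
  simp only [hx, real_inner_smul_left, real_inner_smul_right]

theorem exists_H10_ae_eq (hφ : IsTestFunction L φ) (c : 𝕜) :
    ∃ u : H10 𝕜 L, fn u =ᵐ[volume.restrict (Ioo 0 L)] (fun x => φ x • c) ∧
      dx u =ᵐ[volume.restrict (Ioo 0 L)] fun x => deriv φ x • c := by
  let v : L2 𝕜 L := (hφ.derivative.memLp_smul_const c).toLp
  have hv : v =ᵐ[volume.restrict (Ioo 0 L)] fun x => deriv φ x • c :=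
    MemLp.coeFn_toLp (hφ.derivative.memLp_smul_const c)
  have hprim : ∀ x, prim L v x = φ x • c := fun x => by
    rw [← hφ.prim_deriv x, prim, prim, ← integral_smul_const]
    exact integral_congr_ae (ae_restrict_of_ae hv)
  have hmean : mean 𝕜 L v = 0 := by
    rw [mean_apply, ← prim_right, hprim, hφ.eq_zero_of_notMem right_notMem_Ioo, zero_smul]
  exact ⟨ofDeriv v hmean, (volterra_coeFn v).trans (Eventually.of_forall hprim), hv⟩

end IsTestFunction

theorem hasWeakDeriv_of_inner_dx_eq_neg_inner_fn {f g : L2 𝕜 L}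
    (h : ∀ u : H10 𝕜 L, inner ℝ (dx u) f = -inner ℝ (fn u) g) : HasWeakDeriv L f g := by
  intro φ hφ hc hs
  have hφ : IsTestFunction L φ := ⟨hφ, hc, hs⟩
  refine ext_inner_left ℝ fun c => ?_
  obtain ⟨u, hu, hdu⟩ := hφ.exists_H10_ae_eq c
  rw [inner_neg_right, ← hφ.inner_eq_of_ae_eq hu, ← hφ.derivative.inner_eq_of_ae_eq hdu, h u]

theorem eq_zero_of_inner_fn_eq_zero {g : L2 𝕜 L} (h : ∀ u : H10 𝕜 L, inner ℝ (fn u) g = 0) :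
    g = 0 := by
  have hzero : ∀ᵐ x ∂volume, x ∈ Ioo 0 L → g x = 0 := by
    refine isOpen_Ioo.ae_eq_zero_of_integral_contDiff_smul_eq_zero
      (IntegrableOn.locallyIntegrableOn (L2.integrable g)) fun φ hφ hφc hφs => ?_
    have hφ : IsTestFunction L φ := ⟨hφ, hφc, hφs⟩
    refine ext_inner_left ℝ fun c => ?_
    obtain ⟨u, hu, -⟩ := hφ.exists_H10_ae_eq c
    rw [← hφ.setIntegral_smul, ← hφ.inner_eq_of_ae_eq hu, h u, inner_zero_right]
  refine (Lp.eq_zero_iff_ae_eq_zero).mpr ?_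
  filter_upwards [ae_restrict_of_ae hzero, ae_restrict_mem measurableSet_Ioo] with x hx hxL
  exact hx hxL

end Sobolev

section Multiplication

variable {𝕜 : Type*} [RCLike 𝕜] {L : ℝ} {a : ℝ → ℝ}

theorem memLp_top_of_continuousOn (ha : ContinuousOn a (Icc 0 L)) :
    MemLp a ∞ (volume.restrict (Ioo 0 L)) := by
  obtain ⟨C, hC⟩ := isCompact_Icc.exists_bound_of_continuousOn ha
  refine memLp_top_of_bound
    ((ha.mono Ioo_subset_Icc_self).aestronglyMeasurable measurableSet_Ioo) C ?_
  filter_upwards [ae_restrict_mem measurableSet_Ioo] with x hx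
  exact hC x (Ioo_subset_Icc_self hx)

/-- Multiplication by a function that is continuous on `[0, L]`, as an operator on `L²(0, L)`. -/
def mulOp (𝕜 : Type*) [RCLike 𝕜] (ha : ContinuousOn a (Icc 0 L)) : L2 𝕜 L →L[ℝ] L2 𝕜 L :=
  (ContinuousLinearMap.lsmul ℝ ℝ).holderL (volume.restrict (Ioo 0 L)) ∞ 2 2
    (memLp_top_of_continuousOn ha).toLp

variable (ha : ContinuousOn a (Icc 0 L))

theorem mulOp_coeFn (f : L2 𝕜 L) :
    mulOp 𝕜 ha f =ᵐ[volume.restrict (Ioo 0 L)] fun x => a x • f x := by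
  filter_upwards [ContinuousLinearMap.coeFn_holder (r := 2) (ContinuousLinearMap.lsmul ℝ ℝ)
    (memLp_top_of_continuousOn ha).toLp f, (memLp_top_of_continuousOn ha).coeFn_toLp] with x hx hax
  refine hx.trans ?_
  rw [ContinuousLinearMap.lsmul_apply, hax]

theorem inner_mulOp_left (f g : L2 𝕜 L) :
    inner ℝ (mulOp 𝕜 ha f) g = ∫ x in Ioo 0 L, a x * inner ℝ (f x) (g x) := by
  rw [L2.inner_def]
  refine integral_congr_ae ((mulOp_coeFn ha f).mono fun x hx => ?_)
  simp only [hx, real_inner_smul_left]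

theorem inner_mulOp_comm (f g : L2 𝕜 L) :
    inner ℝ (mulOp 𝕜 ha f) g = inner ℝ f (mulOp 𝕜 ha g) := by
  rw [← real_inner_comm f, inner_mulOp_left, inner_mulOp_left]
  simp only [real_inner_comm]

theorem inner_mulOp_self (f : L2 𝕜 L) :
    inner ℝ (mulOp 𝕜 ha f) f = ∫ x in Ioo 0 L, a x * ‖f x‖ ^ 2 := by
  rw [inner_mulOp_left]
  simp only [real_inner_self_eq_norm_sq]

theorem inner_mulOp_sqrt (hpos : ∀ x ∈ Icc 0 L, 0 < a x) (f g : L2 𝕜 L) :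
    inner ℝ (mulOp 𝕜 ha.sqrt f) (mulOp 𝕜 ha.sqrt g) = inner ℝ (mulOp 𝕜 ha f) g := by
  rw [inner_mulOp_left, inner_mulOp_left]
  refine integral_congr_ae ?_
  filter_upwards [mulOp_coeFn ha.sqrt g, ae_restrict_mem measurableSet_Ioo] with x hx hx'
  rw [hx, real_inner_smul_right, ← mul_assoc,
    Real.mul_self_sqrt (hpos x (Ioo_subset_Icc_self hx')).le]

theorem exists_norm_le_norm_mulOp (hpos : ∀ x ∈ Icc 0 L, 0 < a x) :
    ∃ c, 0 < c ∧ ∀ f : L2 𝕜 L, ‖f‖ ≤ c * ‖mulOp 𝕜 ha f‖ := by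
  let inv := mulOp 𝕜 (ha.inv₀ fun x hx => (hpos x hx).ne')
  refine ⟨‖inv‖ + 1, by positivity, fun f => ?_⟩
  have hinv : f = inv (mulOp 𝕜 ha f) := by
    refine Lp.ext ?_
    filter_upwards [mulOp_coeFn (ha.inv₀ fun x hx => (hpos x hx).ne') (mulOp 𝕜 ha f),
      mulOp_coeFn ha f, ae_restrict_mem measurableSet_Ioo] with x h1 h2 hx
    rw [h1, h2, smul_smul, Pi.inv_apply, inv_mul_cancel₀ (hpos x (Ioo_subset_Icc_self hx)).ne',
      one_smul]
  calc ‖f‖ = ‖inv (mulOp 𝕜 ha f)‖ := by rw [← hinv]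
    _ ≤ ‖inv‖ * ‖mulOp 𝕜 ha f‖ := inv.le_opNorm _
    _ ≤ (‖inv‖ + 1) * ‖mulOp 𝕜 ha f‖ := by gcongr; linarith

theorem exists_mul_norm_sq_le_inner_mulOp (hpos : ∀ x ∈ Icc 0 L, 0 < a x) :
    ∃ c, 0 < c ∧ ∀ f : L2 𝕜 L, c * ‖f‖ ^ 2 ≤ inner ℝ (mulOp 𝕜 ha f) f := by
  obtain ⟨c, hc, hle⟩ := exists_norm_le_norm_mulOp (𝕜 := 𝕜) ha.sqrt
    fun x hx => Real.sqrt_pos.mpr (hpos x hx)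
  refine ⟨(c ^ 2)⁻¹, by positivity, fun f => ?_⟩
  rw [← inner_mulOp_sqrt ha hpos, real_inner_self_eq_norm_sq, inv_mul_le_iff₀ (by positivity),
    ← mul_pow]
  exact pow_le_pow_left₀ (norm_nonneg f) (hle f) 2

end Multiplication

/-- Admissibility for coefficient functions that are merely continuous and for coupling constants
of either sign. -/
structure Params.WeakAdmissible (P : Params) : Prop where
  L_pos : 0 < P.L
  m_cont : ContinuousOn P.m (Icc 0 P.L)
  p_cont : ContinuousOn P.p (Icc 0 P.L)
  δ_cont : ContinuousOn P.δ (Icc 0 P.L)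
  m_pos : ∀ x ∈ Icc 0 P.L, 0 < P.m x
  p_pos : ∀ x ∈ Icc 0 P.L, 0 < P.p x
  δ_pos : ∀ x ∈ Icc 0 P.L, 0 < P.δ x
  κ_ne_zero : P.κ ≠ 0
  β_pos : 0 < P.β
  τ_pos : 0 < P.τ

theorem Params.Admissible.weakAdmissible {P : Params} (hP : P.Admissible) : P.WeakAdmissible where
  L_pos := hP.L_pos
  m_cont := hP.m_reg.1
  p_cont := hP.p_reg.1
  δ_cont := hP.δ_reg.1
  m_pos := hP.m_pos
  p_pos := hP.p_pos
  δ_pos := hP.δ_pos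
  κ_ne_zero := hP.κ_pos.ne'
  β_pos := hP.β_pos
  τ_pos := hP.τ_pos

section Operator

variable {𝕜 : Type*} [RCLike 𝕜] {L : ℝ}

@[simp] theorem dx_zero : dx (0 : H10 𝕜 L) = 0 := rfl
@[simp] theorem dx_add (u v : H10 𝕜 L) : dx (u + v) = dx u + dx v := rfl
@[simp] theorem dx_smul (c : ℝ) (u : H10 𝕜 L) : dx (c • u) = c • dx u := rfl

theorem hasWeakDeriv_iff_inner (hL : 0 < L) {f g : L2 𝕜 L} :
    HasWeakDeriv L f g ↔ ∀ φ : H10 𝕜 L, inner ℝ (dx φ) f = -inner ℝ (fn φ) g :=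
  ⟨HasWeakDeriv.inner_dx_eq_neg_inner_fn hL, hasWeakDeriv_of_inner_dx_eq_neg_inner_fn⟩

theorem inner_dx_fn (hL : 0 < L) (u v : H10 𝕜 L) :
    inner ℝ (dx u) (fn v) = -inner ℝ (fn u) (dx v) :=
  HasWeakDeriv.inner_dx_eq_neg_inner_fn hL v.2.1 u

theorem norm_fn_le (hL : 0 < L) (u : H10 𝕜 L) : ‖fn u‖ ≤ ‖volterra 𝕜 L‖ * ‖dx u‖ := by
  rw [fn_eq_volterra hL]
  exact (volterra 𝕜 L).le_opNorm _

theorem H10.norm_le (hL : 0 < L) (u : H10 𝕜 L) : ‖u‖ ≤ (‖volterra 𝕜 L‖ + 1) * ‖dx u‖ := by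
  rw [add_one_mul]
  exact max_le ((norm_fn_le hL u).trans (le_add_of_nonneg_right (norm_nonneg _)))
    (le_add_of_nonneg_left (by positivity))

theorem fn_injective (hL : 0 < L) : Function.Injective (fn : H10 𝕜 L → L2 𝕜 L) := by
  intro u v h
  refine H10.ext_dx hL (sub_eq_zero.mp (eq_zero_of_inner_fn_eq_zero fun φ => ?_))
  rw [inner_sub_right, sub_eq_zero, ← neg_inj, ← inner_dx_fn hL, ← inner_dx_fn hL, h]

variable {P : Params} (hP : P.WeakAdmissible)

/-- The weak form of the equation `𝒜 (u, w, θ, q) = (w, f₂, f₃, f₄)`, in which both `w` and `θ`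
are elements of `H¹₀(0, L)`. -/
structure IsWeakImage (u w θ : H10 𝕜 P.L) (q f₂ f₃ f₄ : L2 𝕜 P.L) : Prop where
  motion : ∀ φ : H10 𝕜 P.L,
    inner ℝ (dx φ) (mulOp 𝕜 hP.p_cont (dx u) + (2 : ℝ) • mulOp 𝕜 hP.δ_cont (dx w))
      = -inner ℝ (fn φ) (mulOp 𝕜 hP.m_cont f₂ + P.η • dx θ)
  heat : ∀ φ : H10 𝕜 P.L, P.κ * inner ℝ (dx φ) q = inner ℝ (fn φ) (f₃ + P.η • dx w)
  flux : P.τ • f₄ = -(P.κ • dx θ + P.β • q)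

theorem stress_ae_eq (u w : H10 𝕜 P.L) :
    (fun x => (P.p x : 𝕜) * dx u x + 2 * (P.δ x : 𝕜) * dx w x)
      =ᵐ[volume.restrict (Ioo 0 P.L)]
      (mulOp 𝕜 hP.p_cont (dx u) + (2 : ℝ) • mulOp 𝕜 hP.δ_cont (dx w) : L2 𝕜 P.L) := by
  filter_upwards [mulOp_coeFn hP.p_cont (dx u), mulOp_coeFn hP.δ_cont (dx w),
    Lp.coeFn_add (mulOp 𝕜 hP.p_cont (dx u)) ((2 : ℝ) • mulOp 𝕜 hP.δ_cont (dx w)),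
    Lp.coeFn_smul (2 : ℝ) (mulOp 𝕜 hP.δ_cont (dx w))] with x hp hδ hadd hsmul
  rw [hadd, Pi.add_apply, hsmul, Pi.smul_apply, hp, hδ]
  simp only [RCLike.real_smul_eq_coe_mul, RCLike.ofReal_ofNat, mul_assoc]

theorem ae_eq_inv_mul_iff {a : ℝ → ℝ} (ha : ContinuousOn a (Icc 0 L))
    (hne : ∀ x ∈ Icc 0 L, a x ≠ 0) {f g : L2 𝕜 L} {h : ℝ → 𝕜}
    (hg : g =ᵐ[volume.restrict (Ioo 0 L)] h) :
    (∀ᵐ x ∂(volume.restrict (Ioo 0 L)), f x = (a x : 𝕜)⁻¹ * h x) ↔ mulOp 𝕜 ha f = g := by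
  have hiff : ∀ᵐ x ∂(volume.restrict (Ioo 0 L)),
      f x = (a x : 𝕜)⁻¹ * h x ↔ mulOp 𝕜 ha f x = g x := by
    filter_upwards [mulOp_coeFn ha f, hg, ae_restrict_mem measurableSet_Ioo] with x hx hgx hxL
    have hax : (a x : 𝕜) ≠ 0 := RCLike.ofReal_ne_zero.mpr (hne x (Ioo_subset_Icc_self hxL))
    rw [hx, hgx, RCLike.real_smul_eq_coe_mul, eq_inv_mul_iff_mul_eq₀ hax]
  exact (eventually_congr hiff).trans Lp.ext_iff.symm

theorem ae_eq_inv_mul_sub_iff {f σx g : L2 𝕜 P.L} :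
    (∀ᵐ x ∂(volume.restrict (Ioo 0 P.L)),
      f x = (P.m x : 𝕜)⁻¹ * (σx x - (P.η : 𝕜) * g x)) ↔
    mulOp 𝕜 hP.m_cont f + P.η • g = σx := by
  rw [← eq_sub_iff_add_eq]
  refine ae_eq_inv_mul_iff hP.m_cont (fun x hx => (hP.m_pos x hx).ne') ?_
  filter_upwards [Lp.coeFn_sub σx (P.η • g), Lp.coeFn_smul P.η g] with x hsub hsmul
  rw [hsub, Pi.sub_apply, hsmul, Pi.smul_apply, RCLike.real_smul_eq_coe_mul]

theorem isImage_iff {u f₁ : H10 𝕜 P.L} {w θ q f₂ f₃ f₄ : L2 𝕜 P.L} :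
    IsImage P (u, w, θ, q) (f₁, f₂, f₃, f₄) ↔
      fn f₁ = w ∧ ∃ θ', fn θ' = θ ∧ IsWeakImage hP u f₁ θ' q f₂ f₃ f₄ := by
  have ofReal_smul (r : ℝ) (g : L2 𝕜 P.L) : (r : 𝕜) • g = r • g :=
    (RCLike.real_smul_eq_coe_smul (K := 𝕜) r g).symm
  have flux (θ' : H10 𝕜 P.L) : f₄ = -(P.τ : 𝕜)⁻¹ • ((P.κ : 𝕜) • dx θ' + (P.β : 𝕜) • q) ↔
      P.τ • f₄ = -(P.κ • dx θ' + P.β • q) := by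
    rw [← RCLike.ofReal_inv, neg_smul, ofReal_smul, ofReal_smul, ofReal_smul, ← smul_neg,
      eq_inv_smul_iff₀ hP.τ_pos.ne']
  have heat (qx : L2 𝕜 P.L) : f₃ = -(P.κ : 𝕜) • qx - (P.η : 𝕜) • dx f₁ ↔
      -(P.κ⁻¹ • (f₃ + P.η • dx f₁)) = qx := by
    rw [neg_smul, ofReal_smul, ofReal_smul, eq_sub_iff_add_eq, ← smul_neg, ← smul_neg,
      inv_smul_eq_iff₀ hP.κ_ne_zero, smul_neg, neg_eq_iff_eq_neg]
  have weak_heat : HasWeakDeriv P.L q (-(P.κ⁻¹ • (f₃ + P.η • dx f₁)) : L2 𝕜 P.L) ↔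
      ∀ φ : H10 𝕜 P.L, P.κ * inner ℝ (dx φ) q = inner ℝ (fn φ) (f₃ + P.η • dx f₁) := by
    rw [hasWeakDeriv_iff_inner hP.L_pos]
    refine forall_congr' fun φ => ?_
    rw [inner_neg_right, neg_neg, inner_smul_right, eq_inv_mul_iff_mul_eq₀ hP.κ_ne_zero]
  constructor
  · rintro ⟨w', θ', σx, qx, hw, hθ, hσ, hq, rfl, hf₂, hf₃, hf₄⟩
    obtain rfl := (ae_eq_inv_mul_sub_iff hP).mp hf₂
    obtain rfl := (heat qx).mp hf₃
    exact ⟨hw, θ', hθ, (hasWeakDeriv_iff_inner hP.L_pos).mp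
      (hσ.congr (stress_ae_eq hP u f₁) EventuallyEq.rfl), weak_heat.mp hq, (flux θ').mp hf₄⟩
  · rintro ⟨hw, θ', hθ, h⟩
    exact ⟨f₁, θ', _, _, hw, hθ, ((hasWeakDeriv_iff_inner hP.L_pos).mpr h.motion).congr
      (stress_ae_eq hP u f₁).symm EventuallyEq.rfl, weak_heat.mpr h.heat, rfl,
      (ae_eq_inv_mul_sub_iff hP).mpr rfl, (heat _).mpr rfl, (flux θ').mpr h.flux⟩

namespace IsWeakImage

variable {hP} {u w θ u' w' θ' : H10 𝕜 P.L} {q f₂ f₃ f₄ q' f₂' f₃' f₄' : L2 𝕜 P.L}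

theorem isImage (h : IsWeakImage hP u w θ q f₂ f₃ f₄) :
    IsImage P (u, fn w, fn θ, q) (w, f₂, f₃, f₄) :=
  (isImage_iff hP).mpr ⟨rfl, θ, rfl, h⟩

theorem zero : IsWeakImage hP (0 : H10 𝕜 P.L) 0 0 0 0 0 0 where
  motion := by simp
  heat := by simp
  flux := by simp

theorem add (h : IsWeakImage hP u w θ q f₂ f₃ f₄) (h' : IsWeakImage hP u' w' θ' q' f₂' f₃' f₄') :
    IsWeakImage hP (u + u') (w + w') (θ + θ') (q + q') (f₂ + f₂') (f₃ + f₃') (f₄ + f₄') where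
  motion φ := by
    have hm := h.motion φ
    have hm' := h'.motion φ
    simp only [dx_add, map_add, smul_add, inner_add_right] at hm hm' ⊢
    linarith
  heat φ := by
    have hh := h.heat φ
    have hh' := h'.heat φ
    simp only [dx_add, smul_add, inner_add_right] at hh hh' ⊢
    linarith
  flux := by
    simp only [dx_add, smul_add, h.flux, h'.flux]
    abel

theorem smul (c : ℝ) (h : IsWeakImage hP u w θ q f₂ f₃ f₄) :
    IsWeakImage hP (c • u) (c • w) (c • θ) (c • q) (c • f₂) (c • f₃) (c • f₄) where
  motion φ := by
    have hm := h.motion φ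
    simp only [dx_smul, map_smul, inner_smul_right, inner_add_right] at hm ⊢
    linear_combination c * hm
  heat φ := by
    have hh := h.heat φ
    simp only [dx_smul, inner_smul_right, inner_add_right] at hh ⊢
    linear_combination c * hh
  flux := by
    rw [dx_smul, smul_comm P.τ, h.flux, smul_neg, smul_add, smul_comm P.κ, smul_comm P.β]

end IsWeakImage

/-- The graph of `𝒜`. It is taken over `ℝ` also when the states are complex-valued. -/
def opGraph (𝕜 : Type*) [RCLike 𝕜] (hP : P.WeakAdmissible) :
    Submodule ℝ (Phase 𝕜 P.L × Phase 𝕜 P.L) where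
  carrier := {z | IsImage P z.1 z.2}
  add_mem' := by
    rintro ⟨⟨u, w, θ, q⟩, ⟨f₁, f₂, f₃, f₄⟩⟩ ⟨⟨u', w', θ', q'⟩, ⟨f₁', f₂', f₃', f₄'⟩⟩ h h'
    obtain ⟨rfl, θ, rfl, weak⟩ := (isImage_iff hP).mp h
    obtain ⟨rfl, θ', rfl, weak'⟩ := (isImage_iff hP).mp h'
    exact (weak.add weak').isImage
  zero_mem' := (IsWeakImage.zero (hP := hP)).isImage
  smul_mem' := by
    rintro c ⟨⟨u, w, θ, q⟩, ⟨f₁, f₂, f₃, f₄⟩⟩ h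
    obtain ⟨rfl, θ, rfl, weak⟩ := (isImage_iff hP).mp h
    exact (weak.smul c).isImage

theorem memDomPow_iff {k : ℕ} {U : Phase 𝕜 P.L} :
    MemDomPow P k U ↔ U ∈ powDomain (opGraph 𝕜 hP) k := by
  induction k generalizing U with
  | zero => exact iff_of_true trivial trivial
  | succ k ih => exact exists_congr fun F => and_comm.trans (and_congr_left' ih)

theorem eq_zero_of_isImage_zero (hP : P.WeakAdmissible) {F : Phase 𝕜 P.L} (h : IsImage P 0 F) :
    F = 0 := by
  obtain ⟨f₁, f₂, f₃, f₄⟩ := F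
  obtain ⟨hw, θ, hθ, motion, heat, flux⟩ :=
    (isImage_iff hP (u := 0) (w := 0) (θ := 0) (q := 0)).mp h
  obtain rfl : f₁ = 0 := fn_injective hP.L_pos hw
  obtain rfl : θ = 0 := fn_injective hP.L_pos hθ
  simp only [dx_zero, map_zero, smul_zero, add_zero, inner_zero_right, mul_zero, neg_zero,
    zero_eq_neg] at motion heat flux
  obtain ⟨c, -, hc⟩ := exists_norm_le_norm_mulOp (𝕜 := 𝕜) hP.m_cont hP.m_pos
  have hf₂ : f₂ = 0 := by
    have hle := hc f₂
    rwa [eq_zero_of_inner_fn_eq_zero motion, norm_zero, mul_zero, norm_le_zero_iff] at hle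
  have hf₃ : f₃ = 0 := eq_zero_of_inner_fn_eq_zero fun φ => (heat φ).symm
  have hf₄ : f₄ = 0 := (smul_eq_zero_iff_right hP.τ_pos.ne').mp flux
  rw [hf₂, hf₃, hf₄]
  rfl

end Operator

section Energy

variable {𝕜 : Type*} [RCLike 𝕜] {P : Params}

/-- The map `(u, w, θ, q) ↦ (√p u_x, √m w, θ, √τ q)`, for which `‖energyMap V‖²` is twice the energy
of `V`. -/
def energyMap (𝕜 : Type*) [RCLike 𝕜] (hP : P.WeakAdmissible) :
    Phase 𝕜 P.L →L[ℝ] PiLp 2 (fun _ : Fin 4 => L2 𝕜 P.L) :=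
  let derivative : H10 𝕜 P.L →L[ℝ] L2 𝕜 P.L :=
    (ContinuousLinearMap.snd 𝕜 _ _ ∘L (H10 𝕜 P.L).subtypeL).restrictScalars ℝ
  (PiLp.continuousLinearEquiv 2 ℝ (fun _ : Fin 4 => L2 𝕜 P.L)).symm.toContinuousLinearMap ∘L
    ContinuousLinearMap.pi
      ![mulOp 𝕜 hP.p_cont.sqrt ∘L derivative ∘L .fst ℝ _ _,
        mulOp 𝕜 hP.m_cont.sqrt ∘L .fst ℝ _ _ ∘L .snd ℝ _ _,
        .fst ℝ _ _ ∘L .snd ℝ _ _ ∘L .snd ℝ _ _,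
        √P.τ • (.snd ℝ _ _ ∘L .snd ℝ _ _ ∘L .snd ℝ _ _)]

variable (hP : P.WeakAdmissible)

theorem inner_energyMap (u u' : H10 𝕜 P.L) (w θ q w' θ' q' : L2 𝕜 P.L) :
    inner ℝ (energyMap 𝕜 hP (u, w, θ, q)) (energyMap 𝕜 hP (u', w', θ', q'))
      = inner ℝ (mulOp 𝕜 hP.p_cont (dx u)) (dx u') + inner ℝ (mulOp 𝕜 hP.m_cont w) w'
        + inner ℝ θ θ' + P.τ * inner ℝ q q' := by
  have hτ : inner ℝ (√P.τ • q) (√P.τ • q') = P.τ * inner ℝ q q' := by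
    rw [real_inner_smul_left, real_inner_smul_right, ← mul_assoc, Real.mul_self_sqrt hP.τ_pos.le]
  rw [← inner_mulOp_sqrt hP.p_cont hP.p_pos, ← inner_mulOp_sqrt hP.m_cont hP.m_pos, ← hτ,
    PiLp.inner_apply, Fin.sum_univ_four]
  rfl

theorem stateEnergy_eq (V : Phase 𝕜 P.L) :
    stateEnergy P V = (1 / 2) * ‖energyMap 𝕜 hP V‖ ^ 2 := by
  obtain ⟨u, w, θ, q⟩ := V
  rw [← real_inner_self_eq_norm_sq, inner_energyMap, inner_mulOp_self, inner_mulOp_self,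
    L2.inner_def, L2.inner_def]
  simp only [real_inner_self_eq_norm_sq]
  rfl

theorem norm_phase_le {L : ℝ} (u : H10 𝕜 L) (w θ q : L2 𝕜 L) :
    ‖(u, w, θ, q)‖ ≤ ‖u‖ + ‖w‖ + ‖θ‖ + ‖q‖ := by
  simp only [Prod.norm_mk, add_assoc]
  grw [max_le_add_of_nonneg, max_le_add_of_nonneg, max_le_add_of_nonneg] <;> positivity

theorem exists_antilipschitzWith_energyMap : ∃ c, AntilipschitzWith c (energyMap 𝕜 hP) := by
  obtain ⟨a, ha, hp⟩ := exists_norm_le_norm_mulOp (𝕜 := 𝕜) hP.p_cont.sqrt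
    fun x hx => Real.sqrt_pos.mpr (hP.p_pos x hx)
  obtain ⟨b, hb, hm⟩ := exists_norm_le_norm_mulOp (𝕜 := 𝕜) hP.m_cont.sqrt
    fun x hx => Real.sqrt_pos.mpr (hP.m_pos x hx)
  have hτ : 0 < √P.τ := Real.sqrt_pos.mpr hP.τ_pos
  set J := ‖volterra 𝕜 P.L‖ + 1
  have hJ : 0 ≤ J := by positivity
  refine ⟨⟨J * a + b + 1 + (√P.τ)⁻¹, by positivity⟩,
    AddMonoidHomClass.antilipschitz_of_bound _ fun V => ?_⟩
  obtain ⟨u, w, θ, q⟩ := V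
  set e := ‖energyMap 𝕜 hP (u, w, θ, q)‖
  have he : 0 ≤ e := norm_nonneg _
  have hcomponent := PiLp.norm_apply_le (energyMap 𝕜 hP (u, w, θ, q))
  have hu : ‖u‖ ≤ J * a * e := by
    calc ‖u‖ ≤ J * ‖dx u‖ := H10.norm_le hP.L_pos u
      _ ≤ J * (a * e) := by gcongr; exact (hp _).trans (by gcongr; exact hcomponent 0)
      _ = J * a * e := by ring
  have hw : ‖w‖ ≤ b * e := (hm w).trans (by gcongr; exact hcomponent 1)
  have hθ : ‖θ‖ ≤ e := hcomponent 2
  have hq : ‖q‖ ≤ (√P.τ)⁻¹ * e := by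
    rw [le_inv_mul_iff₀ hτ, ← Real.norm_of_nonneg hτ.le, ← norm_smul]
    exact hcomponent 3
  change _ ≤ (J * a + b + 1 + (√P.τ)⁻¹) * e
  linarith [norm_phase_le u w θ q]

theorem IsWeakImage.inner_energyMap_eq {u w θ : H10 𝕜 P.L} {q f₂ f₃ f₄ : L2 𝕜 P.L}
    (h : IsWeakImage hP u w θ q f₂ f₃ f₄) :
    inner ℝ (energyMap 𝕜 hP (u, fn w, fn θ, q)) (energyMap 𝕜 hP (w, f₂, f₃, f₄))
      = -(2 * inner ℝ (mulOp 𝕜 hP.δ_cont (dx w)) (dx w) + P.β * ‖q‖ ^ 2) := by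
  have motion := h.motion w
  have heat := h.heat θ
  have flux := congrArg (inner ℝ q) h.flux
  have parts := inner_dx_fn hP.L_pos θ w
  simp only [inner_add_right, inner_smul_right, inner_neg_right, real_inner_self_eq_norm_sq]
    at motion heat flux
  rw [real_inner_comm q] at heat
  rw [real_inner_comm (fn w)] at parts
  rw [inner_energyMap, inner_mulOp_comm hP.m_cont, real_inner_comm (dx w),
    real_inner_comm (dx w) (mulOp 𝕜 hP.δ_cont (dx w))]
  linear_combination motion - heat + flux - P.η * parts

theorem exists_dissipation (𝕜 : Type*) [RCLike 𝕜] :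
    ∃ e, 0 < e ∧ ∀ {u w θ : H10 𝕜 P.L} {q f₂ f₃ f₄ : L2 𝕜 P.L},
      IsWeakImage hP u w θ q f₂ f₃ f₄ → e * (‖dx w‖ ^ 2 + ‖q‖ ^ 2) ≤
        -inner ℝ (energyMap 𝕜 hP (u, fn w, fn θ, q)) (energyMap 𝕜 hP (w, f₂, f₃, f₄)) := by
  obtain ⟨d, hd, hδ⟩ := exists_mul_norm_sq_le_inner_mulOp (𝕜 := 𝕜) hP.δ_cont hP.δ_pos
  refine ⟨min (2 * d) P.β, lt_min (by positivity) hP.β_pos, fun {u w θ q _ _ _} h => ?_⟩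
  rw [h.inner_energyMap_eq, neg_neg]
  calc min (2 * d) P.β * (‖dx w‖ ^ 2 + ‖q‖ ^ 2)
      ≤ 2 * d * ‖dx w‖ ^ 2 + P.β * ‖q‖ ^ 2 := by
        rw [mul_add]
        gcongr
        exacts [min_le_left _ _, min_le_right _ _]
    _ ≤ _ := by linarith [hδ (dx w)]

theorem inner_energyMap_nonpos {U F : Phase 𝕜 P.L} (h : IsImage P U F) :
    inner ℝ (energyMap 𝕜 hP U) (energyMap 𝕜 hP F) ≤ 0 := by
  obtain ⟨e, he, dissip⟩ := exists_dissipation hP 𝕜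
  obtain ⟨⟨u, w, θ, q⟩, ⟨f₁, f₂, f₃, f₄⟩⟩ := U, F
  obtain ⟨rfl, θ, rfl, weak⟩ := (isImage_iff hP).mp h
  exact neg_nonneg.mp ((by positivity : 0 ≤ e * (‖dx f₁‖ ^ 2 + ‖q‖ ^ 2)).trans (dissip weak))

namespace IsWeakImage

variable {hP} {u w θ : H10 𝕜 P.L} {q f₂ f₃ f₄ : L2 𝕜 P.L}

theorem norm_dx_temperature_le (h : IsWeakImage hP u w θ q f₂ f₃ f₄) :
    |P.κ| * ‖dx θ‖ ≤ P.τ * ‖f₄‖ + P.β * ‖q‖ := by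
  have hκθ : P.κ • dx θ = -(P.τ • f₄ + P.β • q) := by
    rw [h.flux]
    abel
  calc |P.κ| * ‖dx θ‖ = ‖P.τ • f₄ + P.β • q‖ := by
        rw [← norm_neg (_ + _), ← hκθ, norm_smul, Real.norm_eq_abs]
    _ ≤ ‖P.τ • f₄‖ + ‖P.β • q‖ := norm_add_le _ _
    _ = P.τ * ‖f₄‖ + P.β * ‖q‖ := by
      rw [norm_smul, norm_smul, Real.norm_of_nonneg hP.τ_pos.le, Real.norm_of_nonneg hP.β_pos.le]

-- Test the equation of motion with `u` itself.
theorem inner_mulOp_dx_le (h : IsWeakImage hP u w θ q f₂ f₃ f₄) :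
    inner ℝ (mulOp 𝕜 hP.p_cont (dx u)) (dx u) ≤ ‖dx u‖ * (2 * (‖mulOp 𝕜 hP.δ_cont‖ * ‖dx w‖)
      + ‖volterra 𝕜 P.L‖ * (‖mulOp 𝕜 hP.m_cont‖ * ‖f₂‖ + |P.η| * ‖dx θ‖)) := by
  have hδ : ‖(2 : ℝ) • mulOp 𝕜 hP.δ_cont (dx w)‖ ≤ 2 * (‖mulOp 𝕜 hP.δ_cont‖ * ‖dx w‖) := by
    rw [norm_smul, Real.norm_ofNat]
    gcongr
    exact ContinuousLinearMap.le_opNorm _ _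
  have hm : ‖mulOp 𝕜 hP.m_cont f₂ + P.η • dx θ‖
      ≤ ‖mulOp 𝕜 hP.m_cont‖ * ‖f₂‖ + |P.η| * ‖dx θ‖ := by
    refine (norm_add_le _ _).trans (add_le_add (ContinuousLinearMap.le_opNorm _ _) ?_)
    rw [norm_smul, Real.norm_eq_abs]
  have motion := h.motion u
  rw [inner_add_right, real_inner_comm, ← eq_sub_iff_add_eq] at motion
  calc _ ≤ ‖fn u‖ * ‖mulOp 𝕜 hP.m_cont f₂ + P.η • dx θ‖
        + ‖dx u‖ * ‖(2 : ℝ) • mulOp 𝕜 hP.δ_cont (dx w)‖ := by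
        rw [motion]
        linarith [neg_le_of_abs_le (abs_real_inner_le_norm (fn u)
            (mulOp 𝕜 hP.m_cont f₂ + P.η • dx θ)), neg_le_of_abs_le (abs_real_inner_le_norm (dx u)
            ((2 : ℝ) • mulOp 𝕜 hP.δ_cont (dx w)))]
    _ ≤ ‖volterra 𝕜 P.L‖ * ‖dx u‖ * (‖mulOp 𝕜 hP.m_cont‖ * ‖f₂‖ + |P.η| * ‖dx θ‖)
        + ‖dx u‖ * (2 * (‖mulOp 𝕜 hP.δ_cont‖ * ‖dx w‖)) := by
        gcongr
        exact norm_fn_le hP.L_pos u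
    _ = _ := by ring

end IsWeakImage

theorem exists_norm_dx_le (𝕜 : Type*) [RCLike 𝕜] :
    ∃ c, 0 ≤ c ∧ ∀ {u w θ : H10 𝕜 P.L} {q f₂ f₃ f₄ : L2 𝕜 P.L},
      IsWeakImage hP u w θ q f₂ f₃ f₄ → ‖dx u‖ ≤ c * (‖dx w‖ + ‖f₂‖ + ‖dx θ‖) := by
  obtain ⟨a, ha, hp⟩ := exists_mul_norm_sq_le_inner_mulOp (𝕜 := 𝕜) hP.p_cont hP.p_pos
  set b := 2 * ‖mulOp 𝕜 hP.δ_cont‖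
  set c := ‖volterra 𝕜 P.L‖ * ‖mulOp 𝕜 hP.m_cont‖
  set d := ‖volterra 𝕜 P.L‖ * |P.η|
  refine ⟨a⁻¹ * (b + c + d), by positivity, fun {u w θ q f₂ _ _} h => ?_⟩
  rw [mul_assoc, le_inv_mul_iff₀ ha]
  rcases eq_or_lt_of_le (norm_nonneg (dx u)) with h0 | h0
  · rw [← h0, mul_zero]
    positivity
  refine le_of_mul_le_mul_left ?_ h0
  calc ‖dx u‖ * (a * ‖dx u‖) = a * ‖dx u‖ ^ 2 := by ring
    _ ≤ _ := (hp (dx u)).trans h.inner_mulOp_dx_le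
    _ = ‖dx u‖ * (b * ‖dx w‖ + c * ‖f₂‖ + d * ‖dx θ‖) := by ring
    _ ≤ ‖dx u‖ * (b * (‖dx w‖ + ‖f₂‖ + ‖dx θ‖) + c * (‖dx w‖ + ‖f₂‖ + ‖dx θ‖)
        + d * (‖dx w‖ + ‖f₂‖ + ‖dx θ‖)) := by
      gcongr <;> linarith [norm_nonneg (dx w), norm_nonneg f₂, norm_nonneg (dx θ)]
    _ = _ := by ring

theorem exists_norm_le (𝕜 : Type*) [RCLike 𝕜] :
    ∃ c, 0 ≤ c ∧ ∀ {u w θ g : H10 𝕜 P.L} {q f₃ f₄ : L2 𝕜 P.L},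
      IsWeakImage hP u w θ q (fn g) f₃ f₄ →
      ‖(u, fn w, fn θ, q)‖ ≤ c * (‖dx w‖ + ‖q‖ + ‖dx g‖ + ‖f₄‖) := by
  obtain ⟨a, ha, hdisplacement⟩ := exists_norm_dx_le hP 𝕜
  set J := ‖volterra 𝕜 P.L‖
  have hJ : 0 ≤ J := by positivity
  set b := |P.κ|⁻¹ * (P.τ + P.β)
  have hτ := hP.τ_pos
  have hβ := hP.β_pos
  have hb : 0 ≤ b := by positivity
  refine ⟨(J + 1) * (a * (1 + J + b)) + J + J * b + 1, by positivity,
    fun {u w θ g q _ f₄} h => ?_⟩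
  set s := ‖dx w‖ + ‖q‖ + ‖dx g‖ + ‖f₄‖
  have hs : 0 ≤ s := by positivity
  obtain ⟨hw, hq, hg, hf⟩ : ‖dx w‖ ≤ s ∧ ‖q‖ ≤ s ∧ ‖dx g‖ ≤ s ∧ ‖f₄‖ ≤ s := by
    refine ⟨?_, ?_, ?_, ?_⟩ <;>
      linarith [norm_nonneg (dx w), norm_nonneg q, norm_nonneg (dx g), norm_nonneg f₄]
  have hfn (v : H10 𝕜 P.L) : ‖fn v‖ ≤ J * ‖dx v‖ := norm_fn_le hP.L_pos v
  have hθ : ‖dx θ‖ ≤ b * s := by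
    rw [mul_assoc, le_inv_mul_iff₀ (abs_pos.mpr hP.κ_ne_zero), add_mul]
    exact h.norm_dx_temperature_le.trans (by gcongr)
  have hu : ‖u‖ ≤ (J + 1) * (a * (1 + J + b)) * s := by
    calc ‖u‖ ≤ (J + 1) * ‖dx u‖ := H10.norm_le hP.L_pos u
      _ ≤ (J + 1) * (a * (s + J * s + b * s)) := by
        grw [hdisplacement h, hfn g, hw, hg, hθ]
      _ = _ := by ring
  have hfnw : ‖fn w‖ ≤ J * s := by grw [hfn w, hw]
  have hfnθ : ‖fn θ‖ ≤ J * b * s := by rw [mul_assoc]; grw [hfn θ, hθ]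
  grw [norm_phase_le, hu, hfnw, hfnθ, hq]
  exact le_of_eq (by ring)

theorem add_sq_le_four_mul (a b c d : ℝ) :
    (a + b + c + d) ^ 2 ≤ 4 * (a ^ 2 + b ^ 2 + c ^ 2 + d ^ 2) := by
  linarith [sq_nonneg (a - b), sq_nonneg (a - c), sq_nonneg (a - d), sq_nonneg (b - c),
    sq_nonneg (b - d), sq_nonneg (c - d)]

theorem exists_norm_sq_energyMap_le_dissipation (𝕜 : Type*) [RCLike 𝕜] :
    ∃ C, 0 < C ∧ ∀ {X Y Z : Phase 𝕜 P.L}, IsImage P X Y → IsImage P Y Z →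
      ‖energyMap 𝕜 hP X‖ ^ 2 ≤ C * (-inner ℝ (energyMap 𝕜 hP X) (energyMap 𝕜 hP Y)
        - inner ℝ (energyMap 𝕜 hP Y) (energyMap 𝕜 hP Z)) := by
  obtain ⟨e, he, dissip⟩ := exists_dissipation hP 𝕜
  obtain ⟨c, hc, hnorm⟩ := exists_norm_le hP 𝕜
  set K := ‖energyMap 𝕜 hP‖ * c
  refine ⟨4 * K ^ 2 / e + 1, by positivity, ?_⟩
  rintro ⟨u, w, θ, q⟩ ⟨f₁, f₂, f₃, f₄⟩ ⟨g₁, g₂, g₃, g₄⟩ hXY hYZ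
  obtain ⟨rfl, θ, rfl, weak⟩ := (isImage_iff hP).mp hXY
  obtain ⟨rfl, θ', rfl, weak'⟩ := (isImage_iff hP).mp hYZ
  have hX : ‖energyMap 𝕜 hP (u, fn f₁, fn θ, q)‖
      ≤ K * (‖dx f₁‖ + ‖q‖ + ‖dx g₁‖ + ‖f₄‖) := by
    rw [mul_assoc]
    exact (ContinuousLinearMap.le_opNorm _ _).trans (by gcongr; exact hnorm weak)
  set D := -inner ℝ (energyMap 𝕜 hP (u, fn f₁, fn θ, q)) (energyMap 𝕜 hP (f₁, fn g₁, fn θ', f₄))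
    - inner ℝ (energyMap 𝕜 hP (f₁, fn g₁, fn θ', f₄)) (energyMap 𝕜 hP (g₁, g₂, g₃, g₄))
  have hD : e * (‖dx f₁‖ ^ 2 + ‖q‖ ^ 2 + ‖dx g₁‖ ^ 2 + ‖f₄‖ ^ 2) ≤ D := by
    linarith [dissip weak, dissip weak']
  have hD_nonneg : 0 ≤ D := le_trans (by positivity) hD
  calc ‖energyMap 𝕜 hP (u, fn f₁, fn θ, q)‖ ^ 2
      ≤ (K * (‖dx f₁‖ + ‖q‖ + ‖dx g₁‖ + ‖f₄‖)) ^ 2 := by gcongr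
    _ ≤ K ^ 2 * (4 * (‖dx f₁‖ ^ 2 + ‖q‖ ^ 2 + ‖dx g₁‖ ^ 2 + ‖f₄‖ ^ 2)) := by
      rw [mul_pow]
      gcongr
      exact add_sq_le_four_mul _ _ _ _
    _ = 4 * K ^ 2 / e * (e * (‖dx f₁‖ ^ 2 + ‖q‖ ^ 2 + ‖dx g₁‖ ^ 2 + ‖f₄‖ ^ 2)) := by field_simp
    _ ≤ (4 * K ^ 2 / e + 1) * D := by gcongr; exact le_add_of_nonneg_right zero_le_one

end Energy

section Resolvent

theorem exists_eq_of_isCoercive {V : Type*} [NormedAddCommGroup V] [InnerProductSpace ℝ V]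
    [CompleteSpace V] {B : V →L[ℝ] V →L[ℝ] ℝ} (hB : IsCoercive B) (ℓ : V →L[ℝ] ℝ) :
    ∃ v, B v = ℓ := by
  refine ⟨hB.continuousLinearEquivOfBilin.symm ((InnerProductSpace.toDual ℝ V).symm ℓ),
    ContinuousLinearMap.ext fun y => ?_⟩
  rw [← hB.continuousLinearEquivOfBilin_apply, ContinuousLinearEquiv.apply_symm_apply,
    InnerProductSpace.toDual_symm_apply]

theorem exists_eq_of_isCoercive_of_skew_coupling {V W : Type*} [NormedAddCommGroup V]
    [InnerProductSpace ℝ V] [CompleteSpace V] [NormedAddCommGroup W] [InnerProductSpace ℝ W]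
    [CompleteSpace W] {a : V →L[ℝ] V →L[ℝ] ℝ} {b : W →L[ℝ] W →L[ℝ] ℝ} (ha : IsCoercive a)
    (hb : IsCoercive b) (c : W →L[ℝ] V →L[ℝ] ℝ) (ℓ₁ : V →L[ℝ] ℝ) (ℓ₂ : W →L[ℝ] ℝ) :
    ∃ v w, a v + c w = ℓ₁ ∧ b w - c.flip v = ℓ₂ := by
  let fst := WithLp.fstL 2 ℝ V W
  let snd := WithLp.sndL 2 ℝ V W
  let B : WithLp 2 (V × W) →L[ℝ] WithLp 2 (V × W) →L[ℝ] ℝ :=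
    a.bilinearComp fst fst + c.bilinearComp snd fst
      + (b.bilinearComp snd snd - c.flip.bilinearComp fst snd)
  have hB : IsCoercive B := by
    obtain ⟨α, hα, ha⟩ := ha
    obtain ⟨γ, hγ, hb⟩ := hb
    refine ⟨min α γ, lt_min hα hγ, fun z => ?_⟩
    calc min α γ * ‖z‖ * ‖z‖ = min α γ * (‖z.fst‖ * ‖z.fst‖) + min α γ * (‖z.snd‖ * ‖z.snd‖) := by
          rw [mul_assoc, ← sq, WithLp.prod_norm_sq_eq_of_L2]
          ring
      _ ≤ α * (‖z.fst‖ * ‖z.fst‖) + γ * (‖z.snd‖ * ‖z.snd‖) := by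
          gcongr
          exacts [min_le_left _ _, min_le_right _ _]
      _ ≤ a z.fst z.fst + b z.snd z.snd := by linarith [ha z.fst, hb z.snd]
      _ = a z.fst z.fst + c z.snd z.fst + (b z.snd z.snd - c z.snd z.fst) := by ring
  obtain ⟨z, hz⟩ := exists_eq_of_isCoercive hB (ℓ₁ ∘L fst + ℓ₂ ∘L snd)
  refine ⟨z.fst, z.snd, ContinuousLinearMap.ext fun y => ?_, ContinuousLinearMap.ext fun y => ?_⟩
  · have h : a z.fst y + c z.snd y + (b z.snd 0 - c 0 z.fst) = ℓ₁ y + ℓ₂ 0 :=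
      DFunLike.congr_fun hz (WithLp.toLp 2 (y, 0))
    simpa using h
  · have h : a z.fst 0 + c z.snd 0 + (b z.snd y - c y z.fst) = ℓ₁ 0 + ℓ₂ y :=
      DFunLike.congr_fun hz (WithLp.toLp 2 (0, y))
    simpa using h

/-- The functions in `L²(0, L)` of zero mean, that is the derivatives of the elements of
`H¹₀(0, L)`. Its `L²` norm is the Hilbert norm for which the Lax–Milgram theorem is applied. -/
abbrev MeanZero (𝕜 : Type*) [RCLike 𝕜] (L : ℝ) : Submodule ℝ (L2 𝕜 L) :=
  (mean 𝕜 L : L2 𝕜 L →ₗ[ℝ] 𝕜).ker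

variable {𝕜 : Type*} [RCLike 𝕜] {P : Params}

instance (L : ℝ) : CompleteSpace (MeanZero 𝕜 L) :=
  ((mean 𝕜 L).isClosed_ker).completeSpace_coe

/-- The bilinear form of `l (m w) - ((p / l + 2 δ) w_x)_x`, in terms of the derivative of `w`. -/
def motionForm (𝕜 : Type*) [RCLike 𝕜] (hP : P.WeakAdmissible) (l : ℝ) :
    MeanZero 𝕜 P.L →L[ℝ] MeanZero 𝕜 P.L →L[ℝ] ℝ :=
  let ι := (MeanZero 𝕜 P.L).subtypeL
  let J := volterra 𝕜 P.L ∘L ι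
  l⁻¹ • (innerSL ℝ).bilinearComp (mulOp 𝕜 hP.p_cont ∘L ι) ι
    + (2 : ℝ) • (innerSL ℝ).bilinearComp (mulOp 𝕜 hP.δ_cont ∘L ι) ι
    + l • (innerSL ℝ).bilinearComp (mulOp 𝕜 hP.m_cont ∘L J) J

/-- The bilinear form of `l θ - r θ_xx`, in terms of the derivative of `θ`. -/
def heatForm (𝕜 : Type*) [RCLike 𝕜] (L l r : ℝ) : MeanZero 𝕜 L →L[ℝ] MeanZero 𝕜 L →L[ℝ] ℝ :=
  let ι := (MeanZero 𝕜 L).subtypeL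
  let J := volterra 𝕜 L ∘L ι
  l • (innerSL ℝ).bilinearComp J J + r • (innerSL ℝ).bilinearComp ι ι

theorem isCoercive_motionForm (hP : P.WeakAdmissible) {l : ℝ} (hl : 0 < l) :
    IsCoercive (motionForm 𝕜 hP l) := by
  obtain ⟨d, hd, hδ⟩ := exists_mul_norm_sq_le_inner_mulOp (𝕜 := 𝕜) hP.δ_cont hP.δ_pos
  obtain ⟨a, ha, hp⟩ := exists_mul_norm_sq_le_inner_mulOp (𝕜 := 𝕜) hP.p_cont hP.p_pos
  obtain ⟨b, hb, hm⟩ := exists_mul_norm_sq_le_inner_mulOp (𝕜 := 𝕜) hP.m_cont hP.m_pos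
  refine ⟨2 * d, by positivity, fun v => ?_⟩
  have hp_nonneg : 0 ≤ l⁻¹ * inner ℝ (mulOp 𝕜 hP.p_cont v) (v : L2 𝕜 P.L) :=
    le_trans (by positivity) (mul_le_mul_of_nonneg_left (hp v) (inv_nonneg.mpr hl.le))
  have hm_nonneg : 0 ≤ l * inner ℝ (mulOp 𝕜 hP.m_cont (volterra 𝕜 P.L v)) (volterra 𝕜 P.L v) :=
    le_trans (by positivity) (mul_le_mul_of_nonneg_left (hm _) hl.le)
  calc 2 * d * ‖v‖ * ‖v‖ = 2 * (d * ‖(v : L2 𝕜 P.L)‖ ^ 2) := by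
        rw [Submodule.coe_norm]
        ring
    _ ≤ 2 * inner ℝ (mulOp 𝕜 hP.δ_cont v) (v : L2 𝕜 P.L) := by gcongr; exact hδ v
    _ ≤ l⁻¹ * inner ℝ (mulOp 𝕜 hP.p_cont v) (v : L2 𝕜 P.L)
        + 2 * inner ℝ (mulOp 𝕜 hP.δ_cont v) (v : L2 𝕜 P.L)
        + l * inner ℝ (mulOp 𝕜 hP.m_cont (volterra 𝕜 P.L v)) (volterra 𝕜 P.L v) := by linarith

theorem isCoercive_heatForm {L l r : ℝ} (hl : 0 ≤ l) (hr : 0 < r) :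
    IsCoercive (heatForm 𝕜 L l r) := by
  refine ⟨r, hr, fun v => ?_⟩
  calc r * ‖v‖ * ‖v‖ = r * inner ℝ (v : L2 𝕜 L) (v : L2 𝕜 L) := by
        rw [real_inner_self_eq_norm_mul_norm, mul_assoc, Submodule.coe_norm]
    _ ≤ l * inner ℝ (volterra 𝕜 L v) (volterra 𝕜 L v) + r * inner ℝ (v : L2 𝕜 L) (v : L2 𝕜 L) :=
        le_add_of_nonneg_left (mul_nonneg hl real_inner_self_nonneg)

theorem exists_weak_solution (hP : P.WeakAdmissible) {l r : ℝ} (hl : 0 < l) (hr : 0 < r)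
    (h₁ h₂ h₃ h₄ : L2 𝕜 P.L) :
    ∃ w θ : H10 𝕜 P.L,
      (∀ φ : H10 𝕜 P.L, l⁻¹ * inner ℝ (mulOp 𝕜 hP.p_cont (dx w)) (dx φ)
        + 2 * inner ℝ (mulOp 𝕜 hP.δ_cont (dx w)) (dx φ)
        + l * inner ℝ (mulOp 𝕜 hP.m_cont (fn w)) (fn φ)
        + P.η * inner ℝ (dx θ) (fn φ) = inner ℝ h₁ (fn φ) + inner ℝ h₂ (dx φ)) ∧
      ∀ φ : H10 𝕜 P.L, l * inner ℝ (fn θ) (fn φ) + r * inner ℝ (dx θ) (dx φ)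
        - P.η * inner ℝ (dx φ) (fn w) = inner ℝ h₃ (fn φ) + inner ℝ h₄ (dx φ) := by
  let ι := (MeanZero 𝕜 P.L).subtypeL
  let J := volterra 𝕜 P.L ∘L ι
  let c : MeanZero 𝕜 P.L →L[ℝ] MeanZero 𝕜 P.L →L[ℝ] ℝ := P.η • (innerSL ℝ).bilinearComp ι J
  obtain ⟨v, t, motion, heat⟩ := exists_eq_of_isCoercive_of_skew_coupling
    (isCoercive_motionForm (𝕜 := 𝕜) hP hl) (isCoercive_heatForm (𝕜 := 𝕜) (L := P.L) hl.le hr) c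
    (innerSL ℝ h₁ ∘L J + innerSL ℝ h₂ ∘L ι) (innerSL ℝ h₃ ∘L J + innerSL ℝ h₄ ∘L ι)
  have hL := hP.L_pos
  refine ⟨ofDeriv v v.2, ofDeriv t t.2, fun φ => ?_, fun φ => ?_⟩
  · rw [fn_eq_volterra hL φ]
    exact DFunLike.congr_fun motion ⟨dx φ, mean_dx hL φ⟩
  · rw [fn_eq_volterra hL φ]
    exact DFunLike.congr_fun heat ⟨dx φ, mean_dx hL φ⟩

/-- Elimination of `u` and `q` from the resolvent equation leaves a coupled elliptic system for
`w` and `θ`, whose coupling is skew. -/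
theorem exists_isImage_resolvent (hP : P.WeakAdmissible) {l : ℝ} (hl : 0 < l)
    (F : Phase 𝕜 P.L) : ∃ U G : Phase 𝕜 P.L, IsImage P U G ∧ l • U - G = F := by
  obtain ⟨f₁, f₂, f₃, f₄⟩ := F
  have hτ := hP.τ_pos
  have hβ := hP.β_pos
  have hκ : 0 < P.κ ^ 2 := by have := hP.κ_ne_zero; positivity
  have hs : 0 < l * P.τ + P.β := by positivity
  set s := (l * P.τ + P.β)⁻¹
  obtain ⟨w, θ, motion, heat⟩ := exists_weak_solution hP hl (r := P.κ ^ 2 * s) (by positivity)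
    (mulOp 𝕜 hP.m_cont f₂) (-(l⁻¹ • mulOp 𝕜 hP.p_cont (dx f₁))) f₃ ((P.κ * s * P.τ) • f₄)
  let q : L2 𝕜 P.L := s • (P.τ • f₄ - P.κ • dx θ)
  have hq : P.τ • (l • q - f₄) = -(P.κ • dx θ + P.β • q) := by
    have h : (l * P.τ + P.β) • q = P.τ • f₄ - P.κ • dx θ := smul_inv_smul₀ hs.ne' _
    rw [smul_sub, smul_smul, mul_comm P.τ, eq_sub_of_add_eq ((add_smul _ _ q).symm.trans h)]
    abel
  have weak : IsWeakImage hP (l⁻¹ • (w + f₁)) w θ q (l • fn w - f₂) (l • fn θ - f₃)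
      (l • q - f₄) := by
    refine ⟨fun φ => ?_, fun φ => ?_, hq⟩
    · have h := motion φ
      simp only [dx_smul, dx_add, map_add, map_sub, map_smul, inner_add_right, inner_sub_right,
        inner_smul_right, inner_neg_left, real_inner_smul_left] at h ⊢
      simp only [real_inner_comm] at h ⊢
      linear_combination h
    · have h := heat φ
      rw [inner_dx_fn hP.L_pos] at h
      simp only [q, inner_add_right, inner_sub_right, inner_smul_right, real_inner_smul_left] at h ⊢
      simp only [real_inner_comm] at h ⊢
      linear_combination -h
  refine ⟨_, _, weak.isImage, ?_⟩
  have h (a b : L2 𝕜 P.L) : l • a - (l • a - b) = b := sub_sub_cancel _ _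
  refine Prod.ext ?_ (Prod.ext (h _ _) (Prod.ext (h _ _) (h _ _)))
  exact sub_eq_of_eq_add' (smul_inv_smul₀ hl.ne' _)

end Resolvent

section Solutions

variable {𝕜 : Type*} [RCLike 𝕜] {P : Params}

theorem exists_isSolutionFamily_opGraph (𝕜 : Type*) [RCLike 𝕜] (hP : P.WeakAdmissible) :
    ∃ S, IsSolutionFamily (opGraph 𝕜 hP) S := by
  have : CompleteSpace (H10 𝕜 P.L) := (isClosed_H10 hP.L_pos).completeSpace_coe
  obtain ⟨c, hc⟩ := exists_antilipschitzWith_energyMap (𝕜 := 𝕜) hP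
  exact exists_isSolutionFamily_of_antilipschitz hc (inner_energyMap_nonpos hP)
    (eq_zero_of_isImage_zero hP) fun _ hl F => exists_isImage_resolvent hP hl F

theorem IsSolutionFamily.isStrongSolution {hP : P.WeakAdmissible}
    {S : ℝ → Phase 𝕜 P.L → Phase 𝕜 P.L} (hS : IsSolutionFamily (opGraph 𝕜 hP) S)
    {U₀ F : Phase 𝕜 P.L} (h : IsImage P U₀ F) :
    IsStrongSolution P U₀ fun t => S t U₀ where
  init := hS.zero_apply U₀
  contDiffOn := by exact_mod_cast hS.contDiffOn (k := 1) ⟨F, trivial, h⟩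
  eqn t ht := hS.derivWithin h ht ▸ hS.mem h ht

theorem IsStrongSolution.eqOn (hP : P.WeakAdmissible) {U₀ : Phase 𝕜 P.L} {U V : ℝ → Phase 𝕜 P.L}
    (hU : IsStrongSolution P U₀ U) (hV : IsStrongSolution P U₀ V) : EqOn U V (Ici 0) := by
  obtain ⟨c, hc⟩ := exists_antilipschitzWith_energyMap (𝕜 := 𝕜) hP
  have solves {W : ℝ → Phase 𝕜 P.L} (hW : IsStrongSolution P U₀ W) (t : ℝ) (ht : 0 ≤ t) :
      (W t, derivWithin W (Ici 0) t) ∈ opGraph 𝕜 hP ∧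
        HasDerivWithinAt W (derivWithin W (Ici 0) t) (Ici 0) t :=
    ⟨hW.eqn t ht, (hW.contDiffOn.differentiableOn one_ne_zero t ht).hasDerivWithinAt⟩
  exact eqOn_of_inner_nonpos hc.injective (inner_energyMap_nonpos hP) (solves hU) (solves hV)
    (hU.init.trans hV.init.symm)

theorem exists_energy_le (𝕜 : Type*) [RCLike 𝕜] (hP : P.WeakAdmissible) :
    ∃ C, 0 < C ∧ ∀ {S : ℝ → Phase 𝕜 P.L → Phase 𝕜 P.L}, IsSolutionFamily (opGraph 𝕜 hP) S →
      ∀ {n : ℕ}, 1 ≤ n → ∀ {U₀ : Phase 𝕜 P.L}, MemDomPow P (n + 1) U₀ → ∀ {t : ℝ}, 0 < t →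
        energy P n (fun s => S s U₀) t ≤
          C * (energy P n (fun s => S s U₀) 0 + energy P (n + 1) (fun s => S s U₀) 0) / t := by
  obtain ⟨C, hC, control⟩ := exists_norm_sq_energyMap_le_dissipation hP 𝕜
  refine ⟨C, hC, fun {S} hS {n} hn {U₀} hU₀ {t} ht => ?_⟩
  obtain ⟨k, rfl⟩ := Nat.exists_eq_add_of_le' hn
  have hdecay := hS.mul_norm_sq_iteratedDerivWithin_le hC.le (inner_energyMap_nonpos hP) control
    ((memDomPow_iff hP).mp hU₀) ht.le
  rw [le_div_iff₀ ht]
  simp only [energy, stateEnergy_eq hP, Nat.add_sub_cancel]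
  linarith

end Solutions

end Cattaneo

end

theorem theorem3p1_general {𝕜 : Type*} [RCLike 𝕜] (P : Cattaneo.Params) (hP : P.WeakAdmissible) :
    ∃ C : ℝ, 0 < C ∧
      ∀ n : ℕ, 1 ≤ n → ∀ U₀ : Cattaneo.Phase 𝕜 P.L, Cattaneo.MemDomPow P (n + 1) U₀ →
        ∃ U : ℝ → Cattaneo.Phase 𝕜 P.L,
          Cattaneo.IsStrongSolution P U₀ U ∧
          (∀ V : ℝ → Cattaneo.Phase 𝕜 P.L,
            Cattaneo.IsStrongSolution P U₀ V → Set.EqOn V U (Set.Ici 0)) ∧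
          ContDiffOn ℝ (n + 1) U (Set.Ici 0) ∧
          ∀ t : ℝ, 0 < t →
            Cattaneo.energy P n U t
              ≤ C * (Cattaneo.energy P n U 0 + Cattaneo.energy P (n + 1) U 0) / t := by
  obtain ⟨S, hS⟩ := Cattaneo.exists_isSolutionFamily_opGraph 𝕜 hP
  obtain ⟨C, hC, decay⟩ := Cattaneo.exists_energy_le 𝕜 hP
  refine ⟨C, hC, fun n hn U₀ hU₀ => ⟨fun t => S t U₀, ?_⟩⟩
  obtain ⟨F, hF, -⟩ := id hU₀
  have solution := hS.isStrongSolution hF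
  have smooth := hS.contDiffOn ((Cattaneo.memDomPow_iff hP).mp hU₀)
  exact ⟨solution, fun V hV => hV.eqOn hP solution, mod_cast smooth, fun t => decay hS hn hU₀⟩

theorem theorem3p1 {𝕜 : Type*} [RCLike 𝕜] (P : Cattaneo.Params) (hP : P.Admissible) :
    ∃ C : ℝ, 0 < C ∧
      ∀ n : ℕ, 1 ≤ n → ∀ U₀ : Cattaneo.Phase 𝕜 P.L, Cattaneo.MemDomPow P (n + 1) U₀ →
        ∃ U : ℝ → Cattaneo.Phase 𝕜 P.L,
          Cattaneo.IsStrongSolution P U₀ U ∧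
          (∀ V : ℝ → Cattaneo.Phase 𝕜 P.L,
            Cattaneo.IsStrongSolution P U₀ V → Set.EqOn V U (Set.Ici 0)) ∧
          ContDiffOn ℝ (n + 1) U (Set.Ici 0) ∧
          ∀ t : ℝ, 0 < t →
            Cattaneo.energy P n U t
              ≤ C * (Cattaneo.energy P n U 0 + Cattaneo.energy P (n + 1) U 0) / t :=
  theorem3p1_general P hP.weakAdmissible
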